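/- Let $K$ be a field. For a sequence $(a_1,\dots,a_l)$ of positive integers with semigroup $U=\langle a_1,\dots,a_l\rangle$ write $K[U]=K[t^{a_1},\dots,t^{a_l}]=A/I$ with $A=K[X_1,\dots,X_l]$, $\deg X_p=a_p$, $X_p\mapsto t^{a_p}$, and let $\beta_{i,j}(K[U])=\dim_K\operatorname{Tor}^A_i(K[U],K)_j$ be the graded Betti numbers with respect to the listed generators. Let $n_1<\dots<n_k$ be a telescopic sequence of positive integers: $\gcd(n_1,\dots,n_k)=1$ and, with $d_i=\gcd(n_1,\dots,n_i)$, for each $i=2,\dots,k$ the integer $n_i/d_i$ lies in the semigroup generated by $n_1/d_{i-1},\dots,n_{i-1}/d_{i-1}$. Let $S=\langle n_1,\dots,n_k\rangle$, let $g=g(S)=\max(\mathbb Z\setminus S)$ be its Frobenius number, and let $f\ge 3g+1$ be an odd integer. Put $$T_1=\langle 2n_1,\dots,2n_k,\,f-2g\rangle,\qquad T_2=\langle 2n_1,\dots,2n_k,\,f+2-2g\rangle .$$ Then the defining ideal of $K[S]$ has a minimal system of homogeneous generators consisting of exactly $k-1$ elements. Let $r_1,\dots,r_{k-1}$ be the degrees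 of the members of any such system and put $N_t=2r_t$. For $i,j\ge 0$ let - $P_{ij}$ be the collection of all $i$-element sets $\{t_1,\dots,t_i\}\subseteq\{1,\dots,k-1\}$ with $N_{t_1}+\dots+N_{t_i}=j$; - $Q_{ij}$ be the collection of all $(i-1)$-element sets $\{t_1,\dots,t_{i-1}\}\subseteq\{1,\dots,k-1\}$ with $2(f-2g)+N_{t_1}+\dots+N_{t_{i-1}}=j$; - $R_{ij}$ be the collection of all $(i-1)$-element sets $\{t_1,\dots,t_{i-1}\}\subseteq\{1,\dots,k-1\}$ with $2(f-2g)+4+N_{t_1}+\dots+N_{t_{i-1}}=j$ ($Q_{0j}=R_{0j}=\emptyset$). Then for all $i,j\ge 0$: 1. if $P_{ij}\ne\emptyset$ and $Q_{ij}=R_{ij}=\emptyset$, then $\beta_{i,j}(K[T_2])=\beta_{i,j}(K[T_1])$; 2. if $Q_{ij}\ne\emptyset$ and $P_{ij}=R_{ij}=\emptyset$, then $\beta_{i,j}(K[T_2])=0$; 3. if $R_{ij}$ has exactly one element and $Q_{ij}=\emptyset$, then $\beta_{i,j}(K[T_2])=\beta_{i,j}(K[T_1])+1$; 4. in every case, $\beta_{i,j}(K[T_2])=\beta_{i,j}(K[T_1])-|Q_{ij}|+|R_{ij}|$.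 -/

import Mathlib

/-- The submonoid `⟨n_0, …, n_k⟩` of `ℕ` generated by the values of the sequence `n`. -/
def semigroupOf {l : ℕ} (n : Fin l → ℕ) : AddSubmonoid ℕ :=
  AddSubmonoid.closure (Set.range n)

/-- The Frobenius number `max {x ∈ ℤ | x ∉ S}`; it is `-1` for `S = ℕ`. The maximum exists as
soon as the complement of `S` in `ℕ` is finite. -/
noncomputable def frobeniusNumber (S : AddSubmonoid ℕ) : ℤ :=
  sSup {x : ℤ | ∀ s ∈ S, (s : ℤ) ≠ x}

/-- `gcd (n_0, …, n_i)`. -/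
def initialGcd {l : ℕ} (n : Fin l → ℕ) (i : Fin l) : ℕ :=
  (Finset.Iic i).gcd n

/-- Telescopic sequences `n_0 < n_1 < ⋯ < n_k` of positive integers: the greatest common divisor
of all terms is `1` and, with `d_i = gcd (n_0, …, n_i)`, each `n_{i+1} / d_{i+1}` lies in the
semigroup generated by `n_0 / d_i, …, n_i / d_i`. -/
structure IsTelescopic {k : ℕ} (n : Fin (k + 1) → ℕ) : Prop where
  pos : ∀ i, 0 < n i
  strictMono : StrictMono n
  gcd_eq_one : Finset.univ.gcd n = 1
  mem : ∀ i : Fin k, n i.succ / initialGcd n i.succ ∈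
    AddSubmonoid.closure ((fun l => n l / initialGcd n i.castSucc) '' Set.Iic i.castSucc)

section SemigroupRing

open Polynomial

/-- The semigroup ring `K[t^{n_0}, …, t^{n_{l-1}}]` inside `K[t]`. -/
noncomputable def semigroupRing (K : Type*) [Field K] {l : ℕ} (n : Fin l → ℕ) :
    Subalgebra K K[X] :=
  Algebra.adjoin K (Set.range fun p => (X : K[X]) ^ n p)

/-- The defining ideal `I` of the presentation `K[S] = K[X_0, …, X_{l-1}] / I`, `X_p ↦ t^{n_p}`. -/
noncomputable def definingIdeal (K : Type*) [Field K] {l : ℕ} (n : Fin l → ℕ) :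
    Ideal (MvPolynomial (Fin l) K) :=
  RingHom.ker (MvPolynomial.aeval fun p => (X : K[X]) ^ n p : MvPolynomial (Fin l) K →ₐ[K] K[X])

/-- `r` is the family of degrees of the relations of `K[S]`: the defining ideal has a minimal
system of generators `F_t`, each homogeneous of degree `r t` for the grading `deg X_p = n_p`. -/
def IsRelationDegrees (K : Type*) [Field K] {l q : ℕ} (n : Fin l → ℕ) (r : Fin q → ℕ) : Prop :=
  ∃ F : Fin q → MvPolynomial (Fin l) K,
    (∀ t, MvPolynomial.IsWeightedHomogeneous n (F t) (r t)) ∧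
    Ideal.span (Set.range F) = definingIdeal K n ∧
    ∀ t, F t ∉ Ideal.span (F '' {t}ᶜ)

end SemigroupRing

section Koszul

open Polynomial

/-- The differential of the Koszul complex of `x_0, …, x_{l-1}` in `R`. A chain is written in the
basis `e_J`, `J ⊆ {0, …, l-1}`, as the function `J ↦ c J`, and
`d (e_J) = ∑_{p ∈ J} (-1)^{#{q ∈ J | q < p}} x_p e_{J \ {p}}`. -/
noncomputable def koszulDiff (K : Type*) [Field K] {R : Type*} [CommRing R] [Algebra K R] {l : ℕ}
    (x : Fin l → R) : (Finset (Fin l) → R) →ₗ[K] (Finset (Fin l) → R) where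
  toFun c J := ∑ p ∈ Jᶜ, (-1) ^ (J.filter (· < p)).card * x p * c (insert p J)
  map_add' a b := by
    funext J
    simp [mul_add, Finset.sum_add_distrib]
  map_smul' a b := by
    funext J
    simp [Finset.smul_sum]

/-- The part of homological degree `i` and internal degree `s` of the Koszul complex of
`t^{n_0}, …, t^{n_{l-1}}` over `K[S]`: the chains have coefficients in `K[S] ⊆ K[t]`, and the basis
element `e_J` has homological degree `#J` and internal degree `∑_{p ∈ J} n_p`. -/
noncomputable def koszulChains (K : Type*) [Field K] {l : ℕ} (n : Fin l → ℕ) (i s : ℕ) :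
    Submodule K (Finset (Fin l) → K[X]) where
  carrier := {c | ∀ J, c J ∈ semigroupRing K n ∧ (J.card ≠ i → c J = 0) ∧
    ∀ u, (c J).coeff u ≠ 0 → u + ∑ p ∈ J, n p = s}
  zero_mem' := by
    intro J
    simp
  add_mem' := by
    intro a b ha hb J
    refine ⟨add_mem (ha J).1 (hb J).1, fun h => by simp [(ha J).2.1 h, (hb J).2.1 h],
      fun u hu => ?_⟩
    by_cases h : (a J).coeff u = 0
    · refine (hb J).2.2 u fun h' => hu ?_
      simp [h, h']
    · exact (ha J).2.2 u h
  smul_mem' := by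
    intro z a ha J
    refine ⟨Subalgebra.smul_mem _ (ha J).1 z, fun h => by simp [(ha J).2.1 h],
      fun u hu => (ha J).2.2 u fun h' => hu ?_⟩
    simp [h']

/-- Cycles of the Koszul complex over `K[S]` in bidegree `(i, s)`. -/
noncomputable def koszulCycles (K : Type*) [Field K] {l : ℕ} (n : Fin l → ℕ) (i s : ℕ) :
    Submodule K (Finset (Fin l) → K[X]) :=
  koszulChains K n i s ⊓ LinearMap.ker (koszulDiff K fun p => (X : K[X]) ^ n p)

/-- Boundaries of the Koszul complex over `K[S]` in bidegree `(i, s)`. -/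
noncomputable def koszulBoundaries (K : Type*) [Field K] {l : ℕ} (n : Fin l → ℕ) (i s : ℕ) :
    Submodule K (Finset (Fin l) → K[X]) :=
  (koszulChains K n (i + 1) s).map (koszulDiff K fun p => (X : K[X]) ^ n p)

/-- The graded Betti number `β_{i,s} = dim_K Tor_i^A(K[S], K)_s`, where `A` is the polynomial ring
with one variable for each term of `n`. The graded `Tor` is the homology of the complex obtained
by tensoring with `K[S]` the Koszul resolution of `K` over `A`. -/
noncomputable def bettiNumber (K : Type*) [Field K] {l : ℕ} (n : Fin l → ℕ) (i s : ℕ) : ℕ :=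
  Module.finrank K
    (koszulCycles K n i s ⧸ (koszulBoundaries K n i s).comap (koszulCycles K n i s).subtype)

end Koszul

/-- The sequence `(2 n_0, …, 2 n_{l-1}, m)`. -/
def doubledWith {l : ℕ} (n : Fin l → ℕ) (m : ℕ) : Fin (l + 1) → ℕ :=
  Fin.snoc (α := fun _ => ℕ) (fun p => 2 * n p) m

/-- The representations of `j` as `a + N_{t_1} + ⋯ + N_{t_h}` with `{t_1, …, t_h}` a set of `h`
distinct indices and `h + e = i` (so there are none when `i < e`). -/
def degreeSums {q : ℕ} (N : Fin q → ℕ) (a e i j : ℕ) : Finset (Finset (Fin q)) :=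
  Finset.univ.filter fun A => A.card + e = i ∧ a + ∑ t ∈ A, N t = j

/-! Since `m = f - 2g ≥ g + 1`, both `m` and `m + 2` are odd elements of `S`, so `T₁` and `T₂` are
gluings of `S` with multiplier `2`. For a gluing `⟨a n_0, …, a n_{l-1}, c⟩` with `c ∈ S` nonzero and
coprime to `a`, one relation `X_l ^ a - X ^ u` of degree `a c` is added, and `β_{i, a u} = β_{i, u}
+ β_{i-1, u-c}`, while degrees not divisible by `a` contribute nothing.

No resolution is built for this. By `bettiNumber_eq_homologyDim`, setting `t = 1` turns a graded
strand of the Koszul complex into the simplicial chains on the sets `J` with `s - ∑_{p ∈ J} n_p ∈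
S`. Splitting the faces of the glued complex by the last vertex gives the mapping cone of an
inclusion `Δ_{u-c} ⊆ Δ_u`. Writing `c = n_p + c'` with `c' ∈ S`, coning with apex `p` shows that
this inclusion is zero on homology, so the dimensions add (`homologyDim_eq_add`,
`homologyDim_gluedSeq_mul`).

A telescopic sequence is an iterated gluing starting from `ℕ`; hence `β_{i,j}(K[S])` counts the
`i`-element sets of relations with degree sum `j` (`IsTelescopic.exists_presentation`). One more
gluing gives `|P| + |Q|` for `T₁` and `|P| + |R|` for `T₂`, which implies all four claims. The
choice of minimal relations is immaterial: the number of generators of degree `j` is the dimension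
of the degree `j` part of `I / 𝔪I` (`finrank_generatorSpace`). -/

/-! ### Gluings of numerical semigroups and telescopic sequences. -/

/-- The sequence `(a n_0, …, a n_{l-1}, c)`. -/
def gluedSeq {l : ℕ} (a : ℕ) (n : Fin l → ℕ) (c : ℕ) : Fin (l + 1) → ℕ :=
  Fin.snoc (α := fun _ => ℕ) (fun p => a * n p) c

@[simp] theorem gluedSeq_castSucc {l : ℕ} (a : ℕ) (n : Fin l → ℕ) (c : ℕ) (p : Fin l) :
    gluedSeq a n c p.castSucc = a * n p := by
  simp [gluedSeq]

@[simp] theorem gluedSeq_last {l : ℕ} (a : ℕ) (n : Fin l → ℕ) (c : ℕ) :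
    gluedSeq a n c (Fin.last l) = c := by
  simp [gluedSeq]

theorem mem_semigroupOf {l : ℕ} (n : Fin l → ℕ) (p : Fin l) : n p ∈ semigroupOf n :=
  AddSubmonoid.subset_closure ⟨p, rfl⟩

theorem mem_semigroupOf_gluedSeq {l : ℕ} {a c x : ℕ} {n : Fin l → ℕ} :
    x ∈ semigroupOf (gluedSeq a n c) ↔ ∃ y ∈ semigroupOf n, ∃ v, x = a * y + v * c := by
  have hr : Set.range (gluedSeq a n c) = (AddMonoidHom.mulLeft a) '' Set.range n ∪ {c} := by
    rw [gluedSeq, Fin.range_snoc, ← Set.range_comp, Set.union_singleton]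
    rfl
  rw [semigroupOf, hr, AddSubmonoid.closure_union, ← AddMonoidHom.map_mclosure,
    AddSubmonoid.mem_sup]
  constructor
  · rintro ⟨_, ⟨y, hy, rfl⟩, z, hz, rfl⟩
    obtain ⟨v, rfl⟩ := AddSubmonoid.mem_closure_singleton.1 hz
    exact ⟨y, hy, v, by simp⟩
  · rintro ⟨y, hy, v, rfl⟩
    exact ⟨a * y, ⟨y, hy, rfl⟩, v * c, AddSubmonoid.mem_closure_singleton.2 ⟨v, by simp⟩, rfl⟩

/-- A nonzero element of a semigroup can be reduced by one of the generators. -/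
theorem exists_add_of_mem_semigroupOf {l : ℕ} {n : Fin l → ℕ} {c : ℕ} (hc : c ∈ semigroupOf n)
    (h0 : c ≠ 0) : ∃ p, ∃ c' ∈ semigroupOf n, c = n p + c' := by
  have : c = 0 ∨ ∃ p, ∃ c' ∈ semigroupOf n, c = n p + c' := by
    refine AddSubmonoid.closure_induction (motive := fun x _ =>
      x = 0 ∨ ∃ p, ∃ c' ∈ semigroupOf n, x = n p + c') ?_ ?_ ?_ hc
    · rintro _ ⟨p, rfl⟩
      exact .inr ⟨p, 0, zero_mem _, rfl⟩
    · exact .inl rfl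
    · rintro x y - hy (rfl | ⟨p, c', h, rfl⟩) h2
      · simpa using h2
      · exact .inr ⟨p, c' + y, add_mem h hy, by ring⟩
  exact this.resolve_left h0

/-- The exponent vectors of the elements of a semigroup. -/
theorem exists_weight_eq {l : ℕ} {n : Fin l → ℕ} {c : ℕ} (hc : c ∈ semigroupOf n) :
    ∃ u : Fin l →₀ ℕ, Finsupp.weight n u = c := by
  refine AddSubmonoid.closure_induction (motive := fun x _ =>
      ∃ u : Fin l →₀ ℕ, Finsupp.weight n u = x) ?_ ⟨0, map_zero _⟩ ?_ hc
  · rintro _ ⟨p, rfl⟩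
    exact ⟨Finsupp.single p 1, by simp [Finsupp.weight_single]⟩
  · rintro _ _ - - ⟨u, rfl⟩ ⟨v, rfl⟩
    exact ⟨u + v, map_add _ _ _⟩

/-- With gcd `1` all large integers lie in the semigroup, so the set in `frobeniusNumber` is bounded
above and its `sSup` dominates every gap. -/
theorem mem_semigroupOf_of_frobeniusNumber_lt {l : ℕ} {n : Fin l → ℕ}
    (hn : Finset.univ.gcd n = 1) {m : ℕ} (hm : frobeniusNumber (semigroupOf n) < m) :
    m ∈ semigroupOf n := by
  by_contra h
  obtain ⟨B, hB⟩ := Nat.exists_mem_closure_of_ge (Set.range n)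
  have h1 : Nat.setGcd (Set.range n) = 1 := by
    refine Nat.dvd_one.1 ((Finset.dvd_gcd fun p _ => ?_).trans hn.dvd)
    exact Nat.setGcd_dvd_of_mem ⟨p, rfl⟩
  refine absurd (le_csSup ?_ ?_) (not_le.2 hm)
  · refine ⟨B, fun x hx => ?_⟩
    by_contra! hlt
    lift x to ℕ using by omega
    exact hx x (hB x (by omega) (by simp [h1])) rfl
  · intro s hs hsm
    exact h (by exact_mod_cast (Nat.cast_inj.1 hsm) ▸ hs)

/-- A telescopic sequence with at least two terms is obtained by gluing from a shorter one. -/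
theorem IsTelescopic.exists_eq_gluedSeq {k : ℕ} {n : Fin (k + 2) → ℕ} (hn : IsTelescopic n) :
    ∃ (a c : ℕ) (n' : Fin (k + 1) → ℕ), IsTelescopic n' ∧ 0 < a ∧ 0 < c ∧ a.Coprime c ∧
      c ∈ semigroupOf n' ∧ n = gluedSeq a n' c := by
  -- The gluing has `a = d`, the gcd of all terms but the last; `n'` consists of those terms divided
  -- by `d`, and `c` is the last term.
  obtain ⟨d, hd⟩ : ∃ d, d = initialGcd n (Fin.last k).castSucc := ⟨_, rfl⟩
  have himg : ∀ i : Fin (k + 1), Finset.Iic i.castSucc = (Finset.Iic i).map Fin.castSuccEmb := by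
    intro i
    ext x
    simp only [Finset.mem_Iic, Finset.mem_map, Fin.coe_castSuccEmb]
    constructor
    · intro h
      refine ⟨⟨x, ?_⟩, ?_, rfl⟩
      · have := i.2
        have h' : (x : ℕ) ≤ i := h
        omega
      · exact h
    · rintro ⟨y, hy, rfl⟩
      exact Fin.castSucc_le_castSucc_iff.2 hy
  have hgcd : ∀ i : Fin (k + 1), initialGcd n i.castSucc =
      (Finset.Iic i).gcd fun p => n p.castSucc := by
    intro i
    rw [initialGcd, himg, Finset.map_eq_image, Finset.gcd_image]
    rfl
  have huniv : Finset.Iic (Fin.last k) = Finset.univ := by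
    ext x
    simp [Fin.le_last]
  have hd' : d = Finset.univ.gcd fun p : Fin (k + 1) => n p.castSucc := by
    rw [hd, hgcd, huniv]
  have hdvd : ∀ p : Fin (k + 1), d ∣ n p.castSucc := fun p => by
    rw [hd']; exact Finset.gcd_dvd (Finset.mem_univ p)
  have hd0 : 0 < d := Nat.pos_of_dvd_of_pos (hdvd 0) (hn.pos _)
  have hmul : ∀ p : Fin (k + 1), d * (n p.castSucc / d) = n p.castSucc := fun p =>
    Nat.mul_div_cancel' (hdvd p)
  -- Initial gcds scale by `d` too, so the quotients in the telescopic condition are the same for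
  -- `n` and `n'`.
  have hgcd' : ∀ i : Fin (k + 1), initialGcd n i.castSucc =
      d * initialGcd (fun p : Fin (k + 1) => n p.castSucc / d) i := by
    intro i
    rw [hgcd, initialGcd, ← normalize_eq d, ← Finset.gcd_mul_left]
    simp only [normalize_eq, hmul]
  have hlast : initialGcd n (Fin.last (k + 1)) = 1 := by
    refine Eq.trans ?_ hn.gcd_eq_one
    rw [initialGcd]
    congr 1
    ext x
    simp [Fin.le_last]
  have hone : Finset.univ.gcd (fun p : Fin (k + 1) => n p.castSucc / d) = 1 := by
    have := hgcd' (Fin.last k)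
    rw [← hd, initialGcd, huniv] at this
    exact Nat.eq_of_mul_eq_mul_left hd0 (by rw [← this, mul_one])
  refine ⟨d, n (Fin.last (k + 1)), fun p => n p.castSucc / d, ⟨?_, ?_, hone, ?_⟩, hd0, hn.pos _,
    ?_, ?_, ?_⟩
  · exact fun p => Nat.div_pos (Nat.le_of_dvd (hn.pos _) (hdvd p)) hd0
  · intro p q hpq
    refine Nat.lt_of_mul_lt_mul_left (a := d) ?_
    simp only [hmul]
    exact hn.strictMono (Fin.castSucc_lt_castSucc_iff.2 hpq)
  · intro i
    have := hn.mem i.castSucc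
    rw [Fin.succ_castSucc, hgcd', hgcd', ← Nat.div_div_eq_div_mul] at this
    convert this using 2
    ext x
    constructor
    · rintro ⟨y, hy, rfl⟩
      exact ⟨y.castSucc, Fin.castSucc_le_castSucc_iff.2 hy, by simp [Nat.div_div_eq_div_mul]⟩
    · rintro ⟨y, hy, rfl⟩
      have hy' : y ∈ Finset.Iic i.castSucc.castSucc := Finset.mem_Iic.2 hy
      rw [himg] at hy'
      obtain ⟨z, hz, rfl⟩ := Finset.mem_map.1 hy'
      exact ⟨z, Finset.mem_Iic.1 hz, by simp [Nat.div_div_eq_div_mul]⟩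
  · refine Nat.dvd_one.1 ((Finset.dvd_gcd fun p _ => ?_).trans hn.gcd_eq_one.dvd)
    induction p using Fin.lastCases with
    | last => exact Nat.gcd_dvd_right _ _
    | cast p => exact (Nat.gcd_dvd_left _ _).trans (hdvd p)
  · have := hn.mem (Fin.last k)
    rw [Fin.succ_last, hlast, Nat.div_one, ← hd] at this
    rw [semigroupOf]
    convert this using 2
    ext x
    constructor
    · rintro ⟨y, rfl⟩
      exact ⟨y.castSucc, Fin.castSucc_le_castSucc_iff.2 (Fin.le_last y), rfl⟩
    · rintro ⟨y, hy, rfl⟩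
      have hy' : y ∈ Finset.Iic (Fin.last k).castSucc := Finset.mem_Iic.2 hy
      rw [himg] at hy'
      obtain ⟨z, hz, rfl⟩ := Finset.mem_map.1 hy'
      exact ⟨z, rfl⟩
  · funext p
    induction p using Fin.lastCases with
    | last => simp
    | cast p => simp [hmul]

/-! ### Simplicial chains split along the last vertex. -/

section SplitLast

variable {K : Type*} [Field K] {l : ℕ}

/-- The face of `{0, …, l}` obtained from `J` by adding the last vertex. -/
def withLast (J : Finset (Fin l)) : Finset (Fin (l + 1)) :=
  insert (Fin.last l) (J.map Fin.castSuccEmb)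

/-- The face `J` seen as a face of `{0, …, l}`. -/
def withoutLast (J : Finset (Fin l)) : Finset (Fin (l + 1)) :=
  J.map Fin.castSuccEmb

/-- The faces of `{0, …, l}` are those without and those with the last vertex. -/
theorem exists_withoutLast_or_withLast (J : Finset (Fin (l + 1))) :
    (∃ I, J = withoutLast I) ∨ ∃ I, J = withLast I := by
  have key : ∀ p : Fin l, p.castSucc ∈ J ↔
      p.castSucc ∈ (Finset.univ.filter fun q : Fin l => q.castSucc ∈ J).map Fin.castSuccEmb := by
    intro p
    simp
  by_cases h : Fin.last l ∈ J
  · refine .inr ⟨Finset.univ.filter fun p => p.castSucc ∈ J, ?_⟩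
    ext p
    induction p using Fin.lastCases with
    | last => simp [withLast, h]
    | cast p => simp [withLast, (Fin.castSucc_lt_last p).ne]
  · refine .inl ⟨Finset.univ.filter fun p => p.castSucc ∈ J, ?_⟩
    ext p
    induction p using Fin.lastCases with
    | last => simp [withoutLast, h, (Fin.castSucc_lt_last _).ne]
    | cast p => simp [withoutLast]

@[simp] theorem last_mem_withLast (J : Finset (Fin l)) : Fin.last l ∈ withLast J := by
  simp [withLast]

@[simp] theorem last_notMem_withoutLast (J : Finset (Fin l)) : Fin.last l ∉ withoutLast J := by
  simp [withoutLast, (Fin.castSucc_lt_last _).ne]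

@[simp] theorem castSucc_mem_withLast {J : Finset (Fin l)} {p : Fin l} :
    p.castSucc ∈ withLast J ↔ p ∈ J := by
  simp [withLast, (Fin.castSucc_lt_last p).ne]

@[simp] theorem castSucc_mem_withoutLast {J : Finset (Fin l)} {p : Fin l} :
    p.castSucc ∈ withoutLast J ↔ p ∈ J := by
  simp [withoutLast]

@[simp] theorem card_withoutLast (J : Finset (Fin l)) : (withoutLast J).card = J.card := by
  simp [withoutLast]

@[simp] theorem card_withLast (J : Finset (Fin l)) : (withLast J).card = J.card + 1 := by
  have : Fin.last l ∉ J.map Fin.castSuccEmb := last_notMem_withoutLast J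
  rw [withLast, Finset.card_insert_of_notMem this, Finset.card_map]

theorem sum_withoutLast {M : Type*} [AddCommMonoid M] (J : Finset (Fin l)) (g : Fin (l + 1) → M) :
    ∑ p ∈ withoutLast J, g p = ∑ p ∈ J, g p.castSucc := by
  simp [withoutLast]

theorem sum_withLast {M : Type*} [AddCommMonoid M] (J : Finset (Fin l)) (g : Fin (l + 1) → M) :
    ∑ p ∈ withLast J, g p = g (Fin.last l) + ∑ p ∈ J, g p.castSucc := by
  have : Fin.last l ∉ J.map Fin.castSuccEmb := last_notMem_withoutLast J
  rw [withLast, Finset.sum_insert this, Finset.sum_map]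
  rfl

theorem insert_castSucc_withoutLast (J : Finset (Fin l)) (p : Fin l) :
    insert p.castSucc (withoutLast J) = withoutLast (insert p J) := by
  simp [withoutLast, Finset.map_insert]

theorem insert_castSucc_withLast (J : Finset (Fin l)) (p : Fin l) :
    insert p.castSucc (withLast J) = withLast (insert p J) := by
  rw [withLast, Finset.insert_comm, withLast, Finset.map_insert]
  rfl

theorem insert_last_withoutLast (J : Finset (Fin l)) :
    insert (Fin.last l) (withoutLast J) = withLast J := rfl

theorem erase_last_withLast (J : Finset (Fin l)) :
    (withLast J).erase (Fin.last l) = withoutLast J :=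
  Finset.erase_insert (last_notMem_withoutLast J)

theorem erase_castSucc_withoutLast (J : Finset (Fin l)) (p : Fin l) :
    (withoutLast J).erase p.castSucc = withoutLast (J.erase p) := by
  simp [withoutLast, Finset.map_erase]

theorem erase_castSucc_withLast (J : Finset (Fin l)) (p : Fin l) :
    (withLast J).erase p.castSucc = withLast (J.erase p) := by
  rw [withLast, Finset.erase_insert_of_ne (Fin.castSucc_lt_last p).ne']
  simp [withLast, Finset.map_erase]

theorem card_filter_lt_withoutLast (J : Finset (Fin l)) (p : Fin l) :
    ((withoutLast J).filter (· < p.castSucc)).card = (J.filter (· < p)).card := by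
  rw [withoutLast, Finset.filter_map, Finset.card_map]
  congr 1

theorem card_filter_lt_withLast (J : Finset (Fin l)) (p : Fin l) :
    ((withLast J).filter (· < p.castSucc)).card = (J.filter (· < p)).card := by
  rw [withLast, Finset.filter_insert, if_neg (Fin.castSucc_lt_last p).le.not_gt]
  exact card_filter_lt_withoutLast J p

theorem card_filter_lt_last (J : Finset (Fin l)) :
    ((withoutLast J).filter (· < Fin.last l)).card = J.card := by
  rw [withoutLast, Finset.filter_map, Finset.card_map, Finset.filter_true_of_mem]
  exact fun p _ => Fin.castSucc_lt_last p

variable (K l) in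
/-- The coefficients of a cochain at the faces without the last vertex. -/
def lowerPart : (Finset (Fin (l + 1)) → K) →ₗ[K] (Finset (Fin l) → K) :=
  LinearMap.funLeft K K withoutLast

variable (K l) in
/-- The coefficients of a cochain at the faces with the last vertex. -/
def upperPart : (Finset (Fin (l + 1)) → K) →ₗ[K] (Finset (Fin l) → K) :=
  LinearMap.funLeft K K withLast

@[simp] theorem lowerPart_apply (z : Finset (Fin (l + 1)) → K) (J : Finset (Fin l)) :
    lowerPart K l z J = z (withoutLast J) := rfl

@[simp] theorem upperPart_apply (z : Finset (Fin (l + 1)) → K) (J : Finset (Fin l)) :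
    upperPart K l z J = z (withLast J) := rfl

theorem ext_parts {z w : Finset (Fin (l + 1)) → K} (h0 : lowerPart K l z = lowerPart K l w)
    (h1 : upperPart K l z = upperPart K l w) : z = w := by
  funext J
  obtain ⟨I, rfl⟩ | ⟨I, rfl⟩ := exists_withoutLast_or_withLast J
  · exact congrFun h0 I
  · exact congrFun h1 I

theorem exists_parts (z0 z1 : Finset (Fin l) → K) :
    ∃ z, lowerPart K l z = z0 ∧ upperPart K l z = z1 := by
  refine ⟨fun J => if Fin.last l ∈ J then z1 (Finset.univ.filter fun p => p.castSucc ∈ J)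
    else z0 (Finset.univ.filter fun p => p.castSucc ∈ J), ?_, ?_⟩ <;> funext J <;> simp

variable (K l) in
/-- Multiplication by `(-1) ^ #J` at the face `J`. -/
def alternate : (Finset (Fin l) → K) →ₗ[K] (Finset (Fin l) → K) where
  toFun z J := (-1) ^ J.card * z J
  map_add' a b := by
    funext J
    simp [mul_add]
  map_smul' a b := by
    funext J
    simp [mul_left_comm]

@[simp] theorem alternate_apply (z : Finset (Fin l) → K) (J : Finset (Fin l)) :
    alternate K l z J = (-1) ^ J.card * z J := rfl

@[simp] theorem alternate_alternate (z : Finset (Fin l) → K) :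
    alternate K l (alternate K l z) = z := by
  funext J
  simp [← mul_assoc, ← mul_pow]

variable (K l) in
/-- The differential of the simplicial chain complex on the vertices `0, …, l - 1`. -/
noncomputable def simplicialDiff : (Finset (Fin l) → K) →ₗ[K] (Finset (Fin l) → K) :=
  koszulDiff K fun _ => (1 : K)

theorem koszulDiff_apply {R : Type*} [CommRing R] [Algebra K R] (x : Fin l → R)
    (z : Finset (Fin l) → R) (J : Finset (Fin l)) : koszulDiff K x z J =
      ∑ p ∈ Jᶜ, (-1) ^ (J.filter (· < p)).card * x p * z (insert p J) := rfl

theorem simplicialDiff_apply (z : Finset (Fin l) → K) (J : Finset (Fin l)) :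
    simplicialDiff K l z J =
      ∑ p, if p ∈ J then 0 else (-1) ^ (J.filter (· < p)).card * z (insert p J) := by
  rw [simplicialDiff, koszulDiff_apply]
  refine Finset.sum_subset_zero_on_sdiff (Finset.subset_univ _) (fun p hp => ?_) fun p hp => ?_
  · rw [if_pos (by simpa using hp)]
  · rw [if_neg (Finset.mem_compl.1 hp), mul_one]

theorem simplicialDiff_alternate (z : Finset (Fin l) → K) :
    simplicialDiff K l (alternate K l z) = - alternate K l (simplicialDiff K l z) := by
  funext J
  rw [Pi.neg_apply, alternate_apply, simplicialDiff_apply, simplicialDiff_apply, Finset.mul_sum,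
    ← Finset.sum_neg_distrib]
  refine Finset.sum_congr rfl fun p _ => ?_
  split_ifs with h
  · simp
  · rw [alternate_apply, Finset.card_insert_of_notMem h]
    ring

/-- The last vertex is the largest, so removing it from `withLast J` costs the sign `(-1) ^ #J`.
Together with `upperPart_simplicialDiff` this displays the complex as a mapping cone. -/
theorem lowerPart_simplicialDiff (z : Finset (Fin (l + 1)) → K) :
    lowerPart K l (simplicialDiff K (l + 1) z) =
      simplicialDiff K l (lowerPart K l z) + alternate K l (upperPart K l z) := by
  funext J
  rw [lowerPart_apply, simplicialDiff_apply, Fin.sum_univ_castSucc, Pi.add_apply,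
    simplicialDiff_apply]
  simp [insert_castSucc_withoutLast, insert_last_withoutLast, card_filter_lt_withoutLast,
    card_filter_lt_last]

theorem upperPart_simplicialDiff (z : Finset (Fin (l + 1)) → K) :
    upperPart K l (simplicialDiff K (l + 1) z) = simplicialDiff K l (upperPart K l z) := by
  funext J
  rw [upperPart_apply, simplicialDiff_apply, Fin.sum_univ_castSucc, simplicialDiff_apply]
  simp [insert_castSucc_withLast, card_filter_lt_withLast]

theorem simplicialDiff_simplicialDiff : ∀ {l : ℕ} (z : Finset (Fin l) → K),
    simplicialDiff K l (simplicialDiff K l z) = 0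
  | 0, z => by
    funext J
    simp [simplicialDiff_apply]
  | l + 1, z => by
    apply ext_parts
    · rw [lowerPart_simplicialDiff, lowerPart_simplicialDiff, upperPart_simplicialDiff, map_add,
        simplicialDiff_simplicialDiff, simplicialDiff_alternate]
      simp
    · rw [upperPart_simplicialDiff, upperPart_simplicialDiff, simplicialDiff_simplicialDiff,
        map_zero]

/-- A cycle is the boundary of its cone with apex `p`. -/
theorem exists_simplicialDiff_eq : ∀ {l : ℕ} (p : Fin l) (z : Finset (Fin l) → K),
    simplicialDiff K l z = 0 → ∃ w, simplicialDiff K l w = z ∧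
      ∀ J, w J ≠ 0 → p ∈ J ∧ z (J.erase p) ≠ 0
  | 0, p, _ => p.elim0
  | l + 1, p, z => fun hz => by
    have h0 : simplicialDiff K l (lowerPart K l z) + alternate K l (upperPart K l z) = 0 := by
      rw [← lowerPart_simplicialDiff, hz, map_zero]
    have h1 : simplicialDiff K l (upperPart K l z) = 0 := by
      rw [← upperPart_simplicialDiff, hz, map_zero]
    induction p using Fin.lastCases with
    | last =>
      -- The cone over the lower part; its boundary has the right upper part because `z` is a cycle.
      obtain ⟨w, hw0, hw1⟩ := exists_parts 0 (alternate K l (lowerPart K l z))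
      refine ⟨w, ext_parts ?_ ?_, fun J hJ => ?_⟩
      · rw [lowerPart_simplicialDiff, hw0, hw1]
        simp
      · rw [upperPart_simplicialDiff, hw1, simplicialDiff_alternate, eq_neg_of_add_eq_zero_left h0]
        simp
      · obtain ⟨I, rfl⟩ | ⟨I, rfl⟩ := exists_withoutLast_or_withLast J
        · exact absurd (congrFun hw0 I) hJ
        · have := congrFun hw1 I
          rw [upperPart_apply] at this
          rw [this, alternate_apply] at hJ
          refine ⟨last_mem_withLast I, ?_⟩
          rw [erase_last_withLast]
          exact right_ne_zero_of_mul hJ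
    | cast p =>
      -- The upper part is coned first; its cone `w1` contributes to the lower part of the boundary,
      -- and only the remaining cycle is coned below.
      obtain ⟨w1, hw1, hs1⟩ := exists_simplicialDiff_eq p (upperPart K l z) h1
      obtain ⟨w0, hw0, hs0⟩ := exists_simplicialDiff_eq p (lowerPart K l z - alternate K l w1)
        (by rw [map_sub, simplicialDiff_alternate, hw1, sub_neg_eq_add, h0])
      obtain ⟨w, hl, hu⟩ := exists_parts w0 w1
      refine ⟨w, ext_parts ?_ ?_, fun J hJ => ?_⟩
      · rw [lowerPart_simplicialDiff, hl, hu, hw0, sub_add_cancel]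
      · rw [upperPart_simplicialDiff, hu, hw1]
      · obtain ⟨I, rfl⟩ | ⟨I, rfl⟩ := exists_withoutLast_or_withLast J
        · have hI := hs0 I (by rw [← hl]; exact hJ)
          refine ⟨castSucc_mem_withoutLast.2 hI.1, ?_⟩
          -- The correction by `w1` does not spoil the support condition, since `w1` lives on faces
          -- containing `p`.
          have hI1 : w1 (I.erase p) = 0 := by
            by_contra h
            exact Finset.notMem_erase p I (hs1 _ h).1
          rw [erase_castSucc_withoutLast]
          simpa [hI1] using hI.2
        · have hI := hs1 I (by rw [← hu]; exact hJ)
          refine ⟨castSucc_mem_withLast.2 hI.1, ?_⟩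
          rw [erase_castSucc_withLast]
          exact hI.2

end SplitLast

/-! ### Homology dimensions and mapping cones. -/

section Homology

variable {K : Type*} [Field K] {l : ℕ}

variable (K) in
/-- The chains supported on the set `A` of faces. -/
def supportedOn (A : Set (Finset (Fin l))) : Submodule K (Finset (Fin l) → K) where
  carrier := {z | ∀ J, z J ≠ 0 → J ∈ A}
  zero_mem' J hJ := absurd rfl hJ
  add_mem' {a b} ha hb J hJ := by
    by_cases h : a J = 0
    · exact hb J fun h' => hJ (by simp [h, h'])
    · exact ha J h
  smul_mem' c a ha J hJ := ha J fun h => hJ (by simp [h])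

theorem supportedOn_empty : supportedOn K (∅ : Set (Finset (Fin l))) = ⊥ := by
  refine (Submodule.eq_bot_iff _).2 fun z hz => funext fun J => ?_
  by_contra h
  exact hz J h

variable (K) in
/-- The cycles supported on `B`. -/
noncomputable def cyclesOn (B : Set (Finset (Fin l))) : Submodule K (Finset (Fin l) → K) :=
  supportedOn K B ⊓ LinearMap.ker (simplicialDiff K l)

variable (K) in
/-- The dimension of the space of cycles supported on `B` modulo boundaries of chains supported
on `A`. -/
noncomputable def homologyDim (A B : Set (Finset (Fin l))) : ℕ :=
  Module.finrank K (cyclesOn K B ⧸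
    ((supportedOn K A).map (simplicialDiff K l)).comap (cyclesOn K B).subtype)

theorem finrank_eq_map_add_inf_ker {V W : Type*} [AddCommGroup V] [Module K V]
    [FiniteDimensional K V] [AddCommGroup W] [Module K W] (f : V →ₗ[K] W) (M : Submodule K V) :
    Module.finrank K M =
      Module.finrank K (M.map f) + Module.finrank K ↥(M ⊓ LinearMap.ker f) := by
  have h := LinearMap.finrank_range_add_finrank_ker (f.domRestrict M)
  rw [LinearMap.range_domRestrict] at h
  rw [← h, LinearMap.ker_domRestrict, ← Submodule.finrank_map_subtype_eq,
    Submodule.map_comap_subtype]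

/-- Rank–nullity in subtraction-free form. It reduces homology to dimensions of chains and cycles,
each of which can be split along the last vertex. -/
theorem homologyDim_add {A B : Set (Finset (Fin l))}
    (h : (supportedOn K A).map (simplicialDiff K l) ≤ supportedOn K B) :
    homologyDim K A B + Module.finrank K (supportedOn K A) =
      Module.finrank K (cyclesOn K B) + Module.finrank K (cyclesOn K A) := by
  have hle : (supportedOn K A).map (simplicialDiff K l) ≤ cyclesOn K B := by
    refine le_inf h ?_
    rintro _ ⟨z, -, rfl⟩
    exact simplicialDiff_simplicialDiff z
  have h1 := Submodule.finrank_quotient_add_finrank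
    (((supportedOn K A).map (simplicialDiff K l)).comap (cyclesOn K B).subtype)
  rw [(Submodule.comapSubtypeEquivOfLe hle).finrank_eq] at h1
  have h2 := finrank_eq_map_add_inf_ker (simplicialDiff K l) (supportedOn K A)
  rw [homologyDim, h2, ← add_assoc, h1]
  rfl

theorem homologyDim_empty (A : Set (Finset (Fin l))) : homologyDim K A ∅ = 0 := by
  have : cyclesOn K (∅ : Set (Finset (Fin l))) = ⊥ := by
    rw [cyclesOn, supportedOn_empty, bot_inf_eq]
  have h := Submodule.finrank_quotient_add_finrank
    (((supportedOn K A).map (simplicialDiff K l)).comap (cyclesOn K ∅).subtype)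
  have h0 : Module.finrank K (cyclesOn K (∅ : Set (Finset (Fin l)))) = 0 := by
    rw [this, finrank_bot]
  rw [homologyDim]
  omega

/-- A complex that is a cone has no homology. -/
theorem homologyDim_eq_zero_of_cone {A B : Set (Finset (Fin l))} (p : Fin l)
    (h : ∀ J, p ∈ J → J.erase p ∈ B → J ∈ A) : homologyDim K A B = 0 := by
  have : ((supportedOn K A).map (simplicialDiff K l)).comap (cyclesOn K B).subtype = ⊤ := by
    rw [eq_top_iff]
    rintro ⟨z, hz⟩ -
    obtain ⟨w, hw, hs⟩ := exists_simplicialDiff_eq p z hz.2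
    exact ⟨w, fun J hJ => h J (hs J hJ).1 (hz.1 _ (hs J hJ).2), hw⟩
  rw [homologyDim, this]
  exact Module.finrank_zero_of_subsingleton

/-- Rank–nullity for `upperPart`; on its kernel `lowerPart` is injective. -/
theorem finrank_eq_upper_add_lower (M : Submodule K (Finset (Fin (l + 1)) → K)) :
    Module.finrank K M = Module.finrank K (M.map (upperPart K l)) +
      Module.finrank K ((M ⊓ LinearMap.ker (upperPart K l)).map (lowerPart K l)) := by
  rw [finrank_eq_map_add_inf_ker (upperPart K l) M,
    finrank_eq_map_add_inf_ker (lowerPart K l) (M ⊓ LinearMap.ker (upperPart K l))]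
  have : M ⊓ LinearMap.ker (upperPart K l) ⊓ LinearMap.ker (lowerPart K l) = ⊥ := by
    refine (Submodule.eq_bot_iff _).2 ?_
    rintro z ⟨⟨-, h1⟩, h0⟩
    exact ext_parts (h0.trans (map_zero _).symm) (h1.trans (map_zero _).symm)
  rw [this, finrank_bot, add_zero]

theorem mem_supportedOn_iff_parts {A : Set (Finset (Fin (l + 1)))}
    {z : Finset (Fin (l + 1)) → K} : z ∈ supportedOn K A ↔
      lowerPart K l z ∈ supportedOn K (withoutLast ⁻¹' A) ∧
        upperPart K l z ∈ supportedOn K (withLast ⁻¹' A) := by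
  refine ⟨fun h => ⟨fun J hJ => h _ hJ, fun J hJ => h _ hJ⟩, fun h J hJ => ?_⟩
  obtain ⟨I, rfl⟩ | ⟨I, rfl⟩ := exists_withoutLast_or_withLast J
  · exact h.1 I hJ
  · exact h.2 I hJ

theorem finrank_supportedOn (A : Set (Finset (Fin (l + 1)))) :
    Module.finrank K (supportedOn K A) = Module.finrank K (supportedOn K (withLast ⁻¹' A)) +
      Module.finrank K (supportedOn K (withoutLast ⁻¹' A)) := by
  refine (finrank_eq_upper_add_lower _).trans (congrArg₂ (· + ·)
    (congrArg (fun M : Submodule K (Finset (Fin l) → K) => Module.finrank K M) ?_)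
    (congrArg (fun M : Submodule K (Finset (Fin l) → K) => Module.finrank K M) ?_))
  · ext y
    constructor
    · rintro ⟨z, hz, rfl⟩
      exact (mem_supportedOn_iff_parts.1 hz).2
    · intro hy
      obtain ⟨z, h0, h1⟩ := exists_parts 0 y
      exact ⟨z, mem_supportedOn_iff_parts.2 ⟨h0 ▸ zero_mem _, h1 ▸ hy⟩, h1⟩
  · ext y
    constructor
    · rintro ⟨z, hz, rfl⟩
      exact (mem_supportedOn_iff_parts.1 hz.1).1
    · intro hy
      obtain ⟨z, h0, h1⟩ := exists_parts y 0
      exact ⟨z, ⟨mem_supportedOn_iff_parts.2 ⟨h0 ▸ hy, h1 ▸ zero_mem _⟩, h1⟩, h0⟩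

theorem alternate_mem_supportedOn {A : Set (Finset (Fin l))} {z : Finset (Fin l) → K}
    (h : z ∈ supportedOn K A) : alternate K l z ∈ supportedOn K A :=
  fun J hJ => h J (right_ne_zero_of_mul hJ)

/-- The cycles of a mapping cone, when the map is zero on homology. -/
theorem finrank_cyclesOn {A : Set (Finset (Fin (l + 1)))}
    (h : ∀ z ∈ cyclesOn K (withLast ⁻¹' A),
      ∃ w ∈ supportedOn K (withoutLast ⁻¹' A), simplicialDiff K l w = z) :
    Module.finrank K (cyclesOn K A) = Module.finrank K (cyclesOn K (withLast ⁻¹' A)) +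
      Module.finrank K (cyclesOn K (withoutLast ⁻¹' A)) := by
  refine (finrank_eq_upper_add_lower _).trans (congrArg₂ (· + ·)
    (congrArg (fun M : Submodule K (Finset (Fin l) → K) => Module.finrank K M) ?_)
    (congrArg (fun M : Submodule K (Finset (Fin l) → K) => Module.finrank K M) ?_))
  · ext y
    constructor
    · rintro ⟨z, hz, rfl⟩
      refine ⟨(mem_supportedOn_iff_parts.1 hz.1).2, ?_⟩
      have hd : simplicialDiff K (l + 1) z = 0 := hz.2
      rw [SetLike.mem_coe, LinearMap.mem_ker, ← upperPart_simplicialDiff, hd, map_zero]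
    · intro hy
      -- A cycle `y` on the upper faces lifts to a cycle of the cone because it bounds among the
      -- lower faces; the lower part `alternate K l w` cancels it.
      obtain ⟨w, hw, hwy⟩ := h y hy
      have hd : simplicialDiff K l y = 0 := hy.2
      obtain ⟨z, h0, h1⟩ := exists_parts (alternate K l w) y
      refine ⟨z, ⟨mem_supportedOn_iff_parts.2
        ⟨h0 ▸ alternate_mem_supportedOn hw, h1 ▸ hy.1⟩, ?_⟩, h1⟩
      rw [SetLike.mem_coe, LinearMap.mem_ker]
      refine ext_parts ?_ ?_
      · rw [lowerPart_simplicialDiff, h0, h1, simplicialDiff_alternate, hwy]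
        simp
      · rw [upperPart_simplicialDiff, h1, hd, map_zero]
  · ext y
    constructor
    · rintro ⟨z, ⟨hz, hu⟩, rfl⟩
      refine ⟨(mem_supportedOn_iff_parts.1 hz.1).1, ?_⟩
      have hd : simplicialDiff K (l + 1) z = 0 := hz.2
      have hu' : upperPart K l z = 0 := hu
      have := lowerPart_simplicialDiff z
      rw [hd, hu', map_zero, map_zero, add_zero] at this
      exact this.symm
    · intro hy
      have hd : simplicialDiff K l y = 0 := hy.2
      obtain ⟨z, h0, h1⟩ := exists_parts y 0
      refine ⟨z, ⟨⟨mem_supportedOn_iff_parts.2 ⟨h0 ▸ hy.1, h1 ▸ zero_mem _⟩, ?_⟩, h1⟩, h0⟩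
      rw [SetLike.mem_coe, LinearMap.mem_ker]
      refine ext_parts ?_ ?_
      · rw [lowerPart_simplicialDiff, h0, h1, hd]
        simp
      · rw [upperPart_simplicialDiff, h1, map_zero, map_zero]

/-- The homology of a mapping cone, when the map is zero on homology. -/
theorem homologyDim_eq_add {A B : Set (Finset (Fin (l + 1)))}
    (h : (supportedOn K A).map (simplicialDiff K (l + 1)) ≤ supportedOn K B)
    (hA : ∀ z ∈ cyclesOn K (withLast ⁻¹' A),
      ∃ w ∈ supportedOn K (withoutLast ⁻¹' A), simplicialDiff K l w = z)
    (hB : ∀ z ∈ cyclesOn K (withLast ⁻¹' B),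
      ∃ w ∈ supportedOn K (withoutLast ⁻¹' B), simplicialDiff K l w = z) :
    homologyDim K A B = homologyDim K (withoutLast ⁻¹' A) (withoutLast ⁻¹' B) +
      homologyDim K (withLast ⁻¹' A) (withLast ⁻¹' B) := by
  have e := homologyDim_add h
  have e0 : (supportedOn K (withoutLast ⁻¹' A)).map (simplicialDiff K l) ≤
      supportedOn K (withoutLast ⁻¹' B) := by
    rintro _ ⟨y, hy, rfl⟩
    obtain ⟨z, h0, h1⟩ := exists_parts y 0
    have hz := h ⟨z, mem_supportedOn_iff_parts.2 ⟨h0 ▸ hy, h1 ▸ zero_mem _⟩, rfl⟩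
    have := (mem_supportedOn_iff_parts.1 hz).1
    rwa [lowerPart_simplicialDiff, h0, h1, map_zero, add_zero] at this
  have e1 : (supportedOn K (withLast ⁻¹' A)).map (simplicialDiff K l) ≤
      supportedOn K (withLast ⁻¹' B) := by
    rintro _ ⟨y, hy, rfl⟩
    obtain ⟨z, h0, h1⟩ := exists_parts 0 y
    have hz := h ⟨z, mem_supportedOn_iff_parts.2 ⟨h0 ▸ zero_mem _, h1 ▸ hy⟩, rfl⟩
    have := (mem_supportedOn_iff_parts.1 hz).2
    rwa [upperPart_simplicialDiff, h1] at this
  have e0 := homologyDim_add e0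
  have e1 := homologyDim_add e1
  rw [finrank_supportedOn, finrank_cyclesOn hA, finrank_cyclesOn hB] at e
  omega

end Homology

/-! ### Squarefree divisor complexes of a gluing. -/

section DivisorFaces

variable {K : Type*} [Field K] {l : ℕ}

/-- The `i`-element sets `J` such that `s - ∑_{p ∈ J} n_p` lies in the semigroup of `n`. -/
def divisorFaces (n : Fin l → ℕ) (i s : ℕ) : Set (Finset (Fin l)) :=
  {J | J.card = i ∧ ∃ x ∈ semigroupOf n, x + ∑ p ∈ J, n p = s}

theorem simplicialDiff_mem_supportedOn_divisorFaces (n : Fin l → ℕ) (i s : ℕ) :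
    (supportedOn K (divisorFaces n (i + 1) s)).map (simplicialDiff K l) ≤
      supportedOn K (divisorFaces n i s) := by
  rintro _ ⟨z, hz, rfl⟩ J hJ
  rw [simplicialDiff_apply] at hJ
  obtain ⟨p, -, hp⟩ := Finset.exists_ne_zero_of_sum_ne_zero hJ
  split_ifs at hp with hpJ
  · exact absurd rfl hp
  · obtain ⟨hc, x, hx, h⟩ := hz _ (right_ne_zero_of_mul hp)
    rw [Finset.card_insert_of_notMem hpJ] at hc
    rw [Finset.sum_insert hpJ] at h
    exact ⟨by omega, x + n p, add_mem hx (mem_semigroupOf n p), by omega⟩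

variable {a c : ℕ} {n : Fin l → ℕ}

/-- By coprimality `c` occurs a multiple of `a` times, say `a v'`; after division by `a` the term
`v' c` is absorbed into `S`, as `c ∈ S`. -/
theorem withoutLast_preimage_divisorFaces (ha : 0 < a) (hac : a.Coprime c)
    (hc : c ∈ semigroupOf n) (i u : ℕ) :
    withoutLast ⁻¹' divisorFaces (gluedSeq a n c) i (a * u) = divisorFaces n i u := by
  ext J
  simp only [divisorFaces, Set.mem_preimage, Set.mem_ofPred_eq, card_withoutLast, sum_withoutLast,
    gluedSeq_castSucc, ← Finset.mul_sum]
  refine and_congr_right fun _ => ⟨?_, ?_⟩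
  · rintro ⟨x, hx, h⟩
    obtain ⟨y, hy, v, rfl⟩ := mem_semigroupOf_gluedSeq.1 hx
    have hv : a ∣ v * c := by
      have : a ∣ a * y + v * c + a * ∑ p ∈ J, n p := h ▸ dvd_mul_right a u
      rw [add_right_comm, ← mul_add] at this
      exact (Nat.dvd_add_right (dvd_mul_right _ _)).1 this
    obtain ⟨v', rfl⟩ := hac.dvd_of_dvd_mul_right hv
    refine ⟨y + v' * c, add_mem hy (by simpa using nsmul_mem hc v'), ?_⟩
    refine Nat.eq_of_mul_eq_mul_left ha ?_
    rw [← h]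
    ring
  · rintro ⟨y, hy, rfl⟩
    exact ⟨a * y, mem_semigroupOf_gluedSeq.2 ⟨y, hy, 0, by simp⟩, by ring⟩

/-- The last vertex supplies one further copy of `c`, so `v + 1` copies form a positive multiple of
`a`. What remains is the complex of degree `u - c`, stated additively so that it is empty when the
difference is negative. -/
theorem withLast_preimage_divisorFaces (ha : 0 < a) (hac : a.Coprime c)
    (hc : c ∈ semigroupOf n) (i u : ℕ) :
    withLast ⁻¹' divisorFaces (gluedSeq a n c) i (a * u) =
      {J | J.card + 1 = i ∧ ∃ x ∈ semigroupOf n, x + c + ∑ p ∈ J, n p = u} := by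
  ext J
  simp only [divisorFaces, Set.mem_preimage, Set.mem_ofPred_eq, card_withLast, sum_withLast,
    gluedSeq_castSucc, gluedSeq_last, ← Finset.mul_sum]
  refine and_congr_right fun _ => ⟨?_, ?_⟩
  · rintro ⟨x, hx, h⟩
    obtain ⟨y, hy, v, rfl⟩ := mem_semigroupOf_gluedSeq.1 hx
    have hv : a ∣ (v + 1) * c := by
      have : a ∣ a * y + v * c + (c + a * ∑ p ∈ J, n p) := h ▸ dvd_mul_right a u
      rw [show a * y + v * c + (c + a * ∑ p ∈ J, n p) = a * (y + ∑ p ∈ J, n p) + (v + 1) * c by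
        ring] at this
      exact (Nat.dvd_add_right (dvd_mul_right _ _)).1 this
    obtain ⟨v', hv'⟩ := hac.dvd_of_dvd_mul_right hv
    obtain ⟨v'', rfl⟩ : ∃ v'', v' = v'' + 1 :=
      Nat.exists_eq_succ_of_ne_zero fun h0 => by simp [h0] at hv'
    refine ⟨y + v'' * c, add_mem hy (by simpa using nsmul_mem hc v''), ?_⟩
    refine Nat.eq_of_mul_eq_mul_left ha ?_
    rw [← h]
    calc a * (y + v'' * c + c + ∑ p ∈ J, n p)
        = a * y + (a * (v'' + 1)) * c + a * ∑ p ∈ J, n p := by ring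
      _ = _ := by rw [← hv']; ring
  · rintro ⟨y, hy, rfl⟩
    -- The witness takes `a - 1` copies of `c`; with the vertex this makes `a c`.
    obtain ⟨a', rfl⟩ := Nat.exists_eq_succ_of_ne_zero ha.ne'
    exact ⟨_, mem_semigroupOf_gluedSeq.2 ⟨y, hy, a', rfl⟩, by rw [Nat.succ_eq_add_one]; ring⟩

/-- If `a ∤ s`, every representation uses `c` at least once, so the last vertex can be joined to
every face avoiding it and the complex is a cone. -/
theorem homologyDim_gluedSeq_of_not_dvd {s : ℕ} (hs : ¬ a ∣ s) (i : ℕ) :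
    homologyDim K (divisorFaces (gluedSeq a n c) (i + 1) s)
      (divisorFaces (gluedSeq a n c) i s) = 0 := by
  refine homologyDim_eq_zero_of_cone (Fin.last l) fun J hJ h => ?_
  obtain ⟨I, rfl⟩ | ⟨I, rfl⟩ := exists_withoutLast_or_withLast J
  · exact absurd hJ (last_notMem_withoutLast I)
  rw [erase_last_withLast] at h
  obtain ⟨hc, x, hx, h⟩ := h
  obtain ⟨y, hy, v, rfl⟩ := mem_semigroupOf_gluedSeq.1 hx
  rw [card_withoutLast] at hc
  rw [sum_withoutLast] at h
  simp only [gluedSeq_castSucc, ← Finset.mul_sum] at h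
  obtain ⟨v', rfl⟩ : ∃ v', v = v' + 1 := by
    refine Nat.exists_eq_succ_of_ne_zero fun h0 => hs ?_
    rw [← h, h0, zero_mul, add_zero, ← mul_add]
    exact dvd_mul_right _ _
  refine ⟨by rw [card_withLast, hc], a * y + v' * c, mem_semigroupOf_gluedSeq.2 ⟨y, hy, v', rfl⟩, ?_⟩
  rw [sum_withLast, ← h]
  simp only [gluedSeq_castSucc, gluedSeq_last, ← Finset.mul_sum]
  ring

theorem homologyDim_gluedSeq_mul (ha : 0 < a) (hc0 : c ≠ 0) (hac : a.Coprime c)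
    (hc : c ∈ semigroupOf n) (i u : ℕ) :
    homologyDim K (divisorFaces (gluedSeq a n c) (i + 1) (a * u))
      (divisorFaces (gluedSeq a n c) i (a * u)) =
    homologyDim K (divisorFaces n (i + 1) u) (divisorFaces n i u) +
      homologyDim K {J | J.card + 1 = i + 1 ∧ ∃ x ∈ semigroupOf n, x + c + ∑ p ∈ J, n p = u}
        {J | J.card + 1 = i ∧ ∃ x ∈ semigroupOf n, x + c + ∑ p ∈ J, n p = u} := by
  have hnull : ∀ i, ∀ z ∈ cyclesOn K
      (withLast ⁻¹' divisorFaces (gluedSeq a n c) i (a * u)),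
      ∃ w ∈ supportedOn K (withoutLast ⁻¹' divisorFaces (gluedSeq a n c) i (a * u)),
        simplicialDiff K l w = z := by
    intro i z hz
    rw [withLast_preimage_divisorFaces ha hac hc] at hz
    rw [withoutLast_preimage_divisorFaces ha hac hc]
    -- Joining `p` to a face of degree `u - c` costs `n p`, which is paid for by `c = n p + c'`; the
    -- cone therefore stays in the complex of degree `u`.
    obtain ⟨p, c', hc', rfl⟩ := exists_add_of_mem_semigroupOf hc hc0
    obtain ⟨w, hw, hs⟩ := exists_simplicialDiff_eq p z hz.2
    refine ⟨w, fun J hJ => ?_, hw⟩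
    obtain ⟨hp, hJ'⟩ := hs J hJ
    obtain ⟨h1, x, hx, h2⟩ := hz.1 _ hJ'
    rw [Finset.card_erase_add_one hp] at h1
    refine ⟨h1, x + c', add_mem hx hc', ?_⟩
    rw [← Finset.add_sum_erase _ _ hp]
    omega
  rw [homologyDim_eq_add (simplicialDiff_mem_supportedOn_divisorFaces _ _ _) (hnull _) (hnull _)]
  simp only [withoutLast_preimage_divisorFaces ha hac hc, withLast_preimage_divisorFaces ha hac hc]

end DivisorFaces

/-! ### From Koszul homology to divisor complexes. -/

section BettiNumbers

open Polynomial

variable {K : Type*} [Field K] {l : ℕ}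

theorem coeff_ne_zero_mem_semigroupOf {n : Fin l → ℕ} {P : K[X]} (hP : P ∈ semigroupRing K n)
    {u : ℕ} (hu : P.coeff u ≠ 0) : u ∈ semigroupOf n := by
  have key : ∀ u, P.coeff u ≠ 0 → u ∈ semigroupOf n := by
    refine Algebra.adjoin_induction (p := fun P _ => ∀ u, P.coeff u ≠ 0 → u ∈ semigroupOf n)
      ?_ ?_ ?_ ?_ hP
    · rintro _ ⟨p, rfl⟩ u hu
      rw [coeff_X_pow] at hu
      obtain rfl : u = n p := by
        by_contra h
        exact hu (if_neg h)
      exact mem_semigroupOf n p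
    · intro z u hu
      rw [algebraMap_eq, coeff_C] at hu
      obtain rfl : u = 0 := by
        by_contra h
        exact hu (if_neg h)
      exact zero_mem _
    · intro P Q _ _ h1 h2 u hu
      rw [coeff_add] at hu
      by_cases h : P.coeff u = 0
      · exact h2 u fun h' => hu (by rw [h, h', add_zero])
      · exact h1 u h
    · intro P Q _ _ h1 h2 u hu
      rw [coeff_mul] at hu
      obtain ⟨⟨a, b⟩, hab, hne⟩ := Finset.exists_ne_zero_of_sum_ne_zero hu
      rw [← Finset.HasAntidiagonal.mem_antidiagonal.1 hab]
      exact add_mem (h1 _ (left_ne_zero_of_mul hne)) (h2 _ (right_ne_zero_of_mul hne))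
  exact key u hu

theorem X_pow_mem_semigroupRing {n : Fin l → ℕ} {u : ℕ} (hu : u ∈ semigroupOf n) :
    (X : K[X]) ^ u ∈ semigroupRing K n := by
  refine AddSubmonoid.closure_induction
    (motive := fun u _ => (X : K[X]) ^ u ∈ semigroupRing K n) ?_ ?_ ?_ hu
  · rintro _ ⟨p, rfl⟩
    exact Algebra.subset_adjoin ⟨p, rfl⟩
  · rw [pow_zero]
    exact one_mem _
  · intro u v _ _ hu hv
    rw [pow_add]
    exact mul_mem hu hv

/-- Injectivity is needed only on a subspace `H` containing cycles and boundaries: evaluation at `t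
= 1` is injective on homogeneous chains, not on all chains. -/
theorem finrank_quotient_comap_eq {V W : Type*} [AddCommGroup V] [Module K V] [AddCommGroup W]
    [Module K W] (f : V →ₗ[K] W) {H Z B : Submodule K V} {Z' B' : Submodule K W}
    (hf : Set.InjOn f H) (hZ : Z ≤ H) (hB : B ≤ H) (hZ' : Z.map f = Z') (hB' : B.map f = B') :
    Module.finrank K (Z ⧸ B.comap Z.subtype) = Module.finrank K (Z' ⧸ B'.comap Z'.subtype) := by
  have hmem : ∀ z ∈ Z, f z ∈ Z' := fun z hz => hZ' ▸ Submodule.mem_map_of_mem hz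
  let g : Z ≃ₗ[K] Z' := LinearEquiv.ofBijective (f.restrict hmem) (by
    constructor
    · intro a b h
      exact Subtype.ext (hf (hZ a.2) (hZ b.2) (congrArg Subtype.val h))
    · rintro ⟨y, hy⟩
      rw [← hZ'] at hy
      obtain ⟨z, hz, rfl⟩ := hy
      exact ⟨⟨z, hz⟩, rfl⟩)
  refine (Submodule.Quotient.equiv _ _ g ?_).finrank_eq
  ext y
  constructor
  · rintro ⟨z, hz, rfl⟩
    exact hB' ▸ Submodule.mem_map_of_mem (f := f) (p := B) hz
  · intro hy
    have hy' : (y : W) ∈ B' := hy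
    rw [← hB'] at hy'
    obtain ⟨b, hb, hby⟩ := hy'
    obtain ⟨z, rfl⟩ := g.surjective y
    obtain rfl : b = z := hf (hB hb) (hZ z.2) hby
    exact ⟨z, hb, rfl⟩

variable (K) in
/-- The chains of internal degree `s` of the Koszul complex of `t^{n_0}, …` over `K[t]`. -/
noncomputable def homogeneousChains (n : Fin l → ℕ) (s : ℕ) :
    Submodule K (Finset (Fin l) → K[X]) where
  carrier := {c | ∀ J u, (c J).coeff u ≠ 0 → u + ∑ p ∈ J, n p = s}
  zero_mem' J u h := absurd (by simp) h
  add_mem' {a b} ha hb J u hu := by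
    by_cases h : (a J).coeff u = 0
    · exact hb J u fun h' => hu (by simp [h, h'])
    · exact ha J u h
  smul_mem' z a ha J u hu := ha J u fun h' => hu (by simp [h'])

theorem koszulDiff_mem_homogeneousChains {n : Fin l → ℕ} {s : ℕ} {c : Finset (Fin l) → K[X]}
    (hc : c ∈ homogeneousChains K n s) :
    koszulDiff K (fun p => (X : K[X]) ^ n p) c ∈ homogeneousChains K n s := by
  intro J u hu
  rw [koszulDiff_apply, finsetSum_coeff] at hu
  obtain ⟨p, hp, hne⟩ := Finset.exists_ne_zero_of_sum_ne_zero hu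
  have hsign : ((-1 : K[X]) ^ (J.filter (· < p)).card) =
      C ((-1) ^ (J.filter (· < p)).card) := by simp
  rw [mul_assoc, hsign, coeff_C_mul, coeff_X_pow_mul'] at hne
  have hne := right_ne_zero_of_mul hne
  split_ifs at hne with h
  · have := hc _ _ hne
    rw [Finset.sum_insert (Finset.mem_compl.1 hp)] at this
    omega
  · exact absurd rfl hne

variable (K l) in
/-- Evaluation of the coefficients of a chain at `t = 1`. -/
noncomputable def evalChain : (Finset (Fin l) → K[X]) →ₗ[K] (Finset (Fin l) → K) :=
  (Polynomial.aeval (1 : K)).toLinearMap.compLeft (Finset (Fin l))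

theorem evalChain_apply (c : Finset (Fin l) → K[X]) (J : Finset (Fin l)) :
    evalChain K l c J = (c J).eval 1 := by
  exact congrFun (coe_aeval_eq_eval (1 : K)) (c J)

theorem eq_monomial_of_mem_homogeneousChains {n : Fin l → ℕ} {s : ℕ}
    {c : Finset (Fin l) → K[X]} (hc : c ∈ homogeneousChains K n s) (J : Finset (Fin l)) :
    c J = monomial (s - ∑ p ∈ J, n p) ((c J).eval 1) := by
  have : ∃ z, c J = monomial (s - ∑ p ∈ J, n p) z := by
    refine ⟨(c J).coeff (s - ∑ p ∈ J, n p), ?_⟩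
    ext u
    rw [coeff_monomial]
    split_ifs with h
    · rw [h]
    · by_contra hne
      have := hc J u hne
      omega
  obtain ⟨z, hz⟩ := this
  rw [hz]
  simp

/-- The degree fixes the exponent of each coefficient, so its value at `1` determines it. -/
theorem injOn_evalChain (n : Fin l → ℕ) (s : ℕ) :
    Set.InjOn (evalChain K l) (homogeneousChains K n s) := by
  intro a ha b hb h
  funext J
  have hJ := congrFun h J
  rw [evalChain_apply, evalChain_apply] at hJ
  rw [eq_monomial_of_mem_homogeneousChains ha J, eq_monomial_of_mem_homogeneousChains hb J, hJ]

theorem evalChain_koszulDiff (n : Fin l → ℕ) (c : Finset (Fin l) → K[X]) :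
    evalChain K l (koszulDiff K (fun p => (X : K[X]) ^ n p) c) =
      simplicialDiff K l (evalChain K l c) := by
  funext J
  rw [evalChain_apply, koszulDiff_apply, simplicialDiff, koszulDiff_apply, eval_finsetSum]
  refine Finset.sum_congr rfl fun p _ => ?_
  rw [evalChain_apply]
  simp

theorem koszulChains_le (n : Fin l → ℕ) (i s : ℕ) :
    koszulChains K n i s ≤ homogeneousChains K n s :=
  fun _ hc J => (hc J).2.2

theorem map_evalChain_koszulChains (n : Fin l → ℕ) (i s : ℕ) :
    (koszulChains K n i s).map (evalChain K l) = supportedOn K (divisorFaces n i s) := by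
  ext z
  constructor
  · rintro ⟨c, hc, rfl⟩ J hJ
    rw [evalChain_apply] at hJ
    obtain ⟨h1, h2, h3⟩ := hc J
    have h0 : c J ≠ 0 := fun h => hJ (by simp [h])
    obtain ⟨u, hu⟩ : ∃ u, (c J).coeff u ≠ 0 := by
      by_contra! h
      exact h0 (Polynomial.ext h)
    refine ⟨?_, u, coeff_ne_zero_mem_semigroupOf h1 hu, h3 u hu⟩
    by_contra h
    exact h0 (h2 h)
  · intro hz
    -- The truncated subtraction is harmless: where `z J ≠ 0` the face condition makes it exact, and
    -- elsewhere the monomial is zero.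
    refine ⟨fun J => monomial (s - ∑ p ∈ J, n p) (z J), fun J => ?_, ?_⟩
    · by_cases h : z J = 0
      · simp [h]
      · obtain ⟨hcard, x, hx, hs⟩ := hz J h
        have hsub : s - ∑ p ∈ J, n p = x := by omega
        dsimp only
        rw [hsub]
        refine ⟨?_, fun h' => absurd hcard h', fun u hu => ?_⟩
        · rw [← C_mul_X_pow_eq_monomial, ← smul_eq_C_mul]
          exact Subalgebra.smul_mem _ (X_pow_mem_semigroupRing hx) _
        · rw [coeff_monomial] at hu
          obtain rfl : x = u := by
            by_contra h'
            exact hu (if_neg h')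
          exact hs
    · funext J
      rw [evalChain_apply]
      simp

/-- The graded Betti numbers are the homology dimensions of the squarefree divisor complexes. -/
theorem bettiNumber_eq_homologyDim (n : Fin l → ℕ) (i s : ℕ) :
    bettiNumber K n i s = homologyDim K (divisorFaces n (i + 1) s) (divisorFaces n i s) := by
  refine finrank_quotient_comap_eq (evalChain K l) (injOn_evalChain n s)
    (inf_le_left.trans (koszulChains_le n i s)) ?_ ?_ ?_
  · rintro _ ⟨c, hc, rfl⟩
    exact koszulDiff_mem_homogeneousChains (koszulChains_le _ _ _ hc)
  · ext z
    constructor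
    · rintro ⟨c, ⟨hc, hd⟩, rfl⟩
      refine ⟨(map_evalChain_koszulChains n i s).le (Submodule.mem_map_of_mem hc), ?_⟩
      have hd' : koszulDiff K (fun p => (X : K[X]) ^ n p) c = 0 := hd
      rw [SetLike.mem_coe, LinearMap.mem_ker, ← evalChain_koszulDiff, hd', map_zero]
    · rintro ⟨hz, hd⟩
      rw [SetLike.mem_coe, ← map_evalChain_koszulChains] at hz
      obtain ⟨c, hc, rfl⟩ := hz
      refine ⟨c, ⟨hc, ?_⟩, rfl⟩
      -- The differential of `c` is homogeneous and evaluates to zero, hence is zero.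
      refine injOn_evalChain n s (koszulDiff_mem_homogeneousChains (koszulChains_le _ _ _ hc))
        (zero_mem _) ?_
      rw [evalChain_koszulDiff, map_zero]
      exact hd
  · rw [koszulBoundaries, ← map_evalChain_koszulChains, ← Submodule.map_comp, ← Submodule.map_comp]
    exact congrArg (fun g => Submodule.map g (koszulChains K n (i + 1) s))
      (LinearMap.ext fun c => evalChain_koszulDiff n c)

variable {a c : ℕ} {n : Fin l → ℕ}

/-- This and the next three lemmas are the cases of `β_{i, a u} = β_{i, u} + β_{i-1, u-c}`,
separated so that no negative index occurs. -/
theorem bettiNumber_gluedSeq_of_not_dvd {s : ℕ} (hs : ¬ a ∣ s) (i : ℕ) :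
    bettiNumber K (gluedSeq a n c) i s = 0 := by
  rw [bettiNumber_eq_homologyDim, homologyDim_gluedSeq_of_not_dvd hs]

theorem bettiNumber_gluedSeq_zero (ha : 0 < a) (hc0 : c ≠ 0) (hac : a.Coprime c)
    (hc : c ∈ semigroupOf n) (u : ℕ) :
    bettiNumber K (gluedSeq a n c) 0 (a * u) = bettiNumber K n 0 u := by
  rw [bettiNumber_eq_homologyDim, bettiNumber_eq_homologyDim,
    homologyDim_gluedSeq_mul ha hc0 hac hc]
  simp [homologyDim_empty]

theorem bettiNumber_gluedSeq_of_lt (ha : 0 < a) (hc0 : c ≠ 0) (hac : a.Coprime c)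
    (hc : c ∈ semigroupOf n) {u : ℕ} (hu : u < c) (i : ℕ) :
    bettiNumber K (gluedSeq a n c) i (a * u) = bettiNumber K n i u := by
  rw [bettiNumber_eq_homologyDim, bettiNumber_eq_homologyDim,
    homologyDim_gluedSeq_mul ha hc0 hac hc]
  have : {J : Finset (Fin l) | J.card + 1 = i ∧
      ∃ x ∈ semigroupOf n, x + c + ∑ p ∈ J, n p = u} = ∅ := by
    refine Set.eq_empty_of_forall_notMem ?_
    rintro J ⟨-, x, -, h⟩
    omega
  rw [this, homologyDim_empty, add_zero]

theorem bettiNumber_gluedSeq_succ (ha : 0 < a) (hc0 : c ≠ 0) (hac : a.Coprime c)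
    (hc : c ∈ semigroupOf n) (i u : ℕ) :
    bettiNumber K (gluedSeq a n c) (i + 1) (a * (c + u)) =
      bettiNumber K n (i + 1) (c + u) + bettiNumber K n i u := by
  rw [bettiNumber_eq_homologyDim, bettiNumber_eq_homologyDim, bettiNumber_eq_homologyDim,
    homologyDim_gluedSeq_mul ha hc0 hac hc]
  have : ∀ i, {J : Finset (Fin l) | J.card + 1 = i + 1 ∧
      ∃ x ∈ semigroupOf n, x + c + ∑ p ∈ J, n p = c + u} = divisorFaces n i u := by
    intro i
    ext J
    simp only [divisorFaces, Set.mem_ofPred_eq, Nat.add_right_cancel_iff]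
    refine and_congr_right fun _ => exists_congr fun x => and_congr_right fun _ => ?_
    omega
  rw [this, this]

end BettiNumbers

/-! ### Counting subset sums of relation degrees. -/

section DegreeSums

variable {K : Type*} [Field K] {q : ℕ}

theorem mem_degreeSums {N : Fin q → ℕ} {a e i j : ℕ} {A : Finset (Fin q)} :
    A ∈ degreeSums N a e i j ↔ A.card + e = i ∧ a + ∑ t ∈ A, N t = j := by
  simp [degreeSums]

theorem card_degreeSums_comp (σ : Equiv.Perm (Fin q)) (N : Fin q → ℕ) (a e i j : ℕ) :
    (degreeSums (N ∘ σ) a e i j).card = (degreeSums N a e i j).card := by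
  refine Finset.card_equiv σ.finsetCongr fun A => ?_
  simp [mem_degreeSums]

/-- Sets of indices are sorted by whether they contain the last one; this is the same recursion as
for the Betti numbers of a gluing. -/
theorem card_degreeSums_gluedSeq (D : Fin q → ℕ) (a w i j : ℕ) :
    (degreeSums (gluedSeq a D w) 0 0 i j).card =
      (degreeSums (fun t => a * D t) 0 0 i j).card +
        (degreeSums (fun t => a * D t) w 1 i j).card := by
  have h0 : Function.Injective (withoutLast : Finset (Fin q) → _) :=
    Finset.map_injective _
  have h1 : Function.Injective (withLast : Finset (Fin q) → _) := by
    intro A B h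
    ext p
    rw [← castSucc_mem_withLast, h, castSucc_mem_withLast]
  rw [← Finset.card_map ⟨_, h0⟩, ← Finset.card_map ⟨_, h1⟩, ← Finset.card_union_of_disjoint]
  · congr 1
    ext A
    simp only [Finset.mem_union, Finset.mem_map, Function.Embedding.coeFn_mk]
    obtain ⟨I, rfl⟩ | ⟨I, rfl⟩ := exists_withoutLast_or_withLast A
    · constructor
      · intro h
        refine .inl ⟨I, ?_, rfl⟩
        simpa [mem_degreeSums, sum_withoutLast] using h
      · rintro (⟨I', h, hI⟩ | ⟨I', h, hI⟩)
        · obtain rfl := h0 hI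
          simpa [mem_degreeSums, sum_withoutLast] using h
        · exact absurd (hI ▸ last_mem_withLast I') (last_notMem_withoutLast I)
    · constructor
      · intro h
        refine .inr ⟨I, ?_, rfl⟩
        simpa [mem_degreeSums, sum_withLast] using h
      · rintro (⟨I', h, hI⟩ | ⟨I', h, hI⟩)
        · exact absurd (hI ▸ last_mem_withLast I) (last_notMem_withoutLast I')
        · obtain rfl := h1 hI
          simpa [mem_degreeSums, sum_withLast] using h
  · rw [Finset.disjoint_left]
    simp only [Finset.mem_map, Function.Embedding.coeFn_mk]
    rintro _ ⟨I, -, rfl⟩ ⟨I', -, h⟩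
    exact last_notMem_withoutLast I (h ▸ last_mem_withLast I')

/-- The Betti numbers of a gluing, if those of the original ring are of Koszul type. -/
theorem bettiNumber_gluedSeq {l : ℕ} {n : Fin l → ℕ} {D : Fin q → ℕ} {a c : ℕ}
    (hD : ∀ i j, bettiNumber K n i j = (degreeSums D 0 0 i j).card)
    (ha : 0 < a) (hc0 : c ≠ 0) (hac : a.Coprime c) (hc : c ∈ semigroupOf n) (i j : ℕ) :
    bettiNumber K (gluedSeq a n c) i j =
      (degreeSums (fun t => a * D t) 0 0 i j).card +
        (degreeSums (fun t => a * D t) (a * c) 1 i j).card := by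
  by_cases hj : a ∣ j
  · obtain ⟨u, rfl⟩ := hj
    have hP : degreeSums (fun t => a * D t) 0 0 i (a * u) = degreeSums D 0 0 i u := by
      ext A
      rw [mem_degreeSums, mem_degreeSums, ← Finset.mul_sum, zero_add, zero_add,
        Nat.mul_right_inj ha.ne']
    have hQ : degreeSums (fun t => a * D t) (a * c) 1 i (a * u) = degreeSums D c 1 i u := by
      ext A
      rw [mem_degreeSums, mem_degreeSums, ← Finset.mul_sum, ← mul_add, Nat.mul_right_inj ha.ne']
    rw [hP, hQ]
    rcases i with - | i
    · have : degreeSums D c 1 0 u = ∅ := by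
        refine Finset.eq_empty_of_forall_notMem fun A hA => ?_
        simp [mem_degreeSums] at hA
      rw [bettiNumber_gluedSeq_zero ha hc0 hac hc, hD, this, Finset.card_empty, add_zero]
    · rcases lt_or_ge u c with hu | hu
      · have : degreeSums D c 1 (i + 1) u = ∅ := by
          refine Finset.eq_empty_of_forall_notMem fun A hA => ?_
          have := (mem_degreeSums.1 hA).2
          omega
        rw [bettiNumber_gluedSeq_of_lt ha hc0 hac hc hu, hD, this, Finset.card_empty, add_zero]
      · obtain ⟨v, rfl⟩ := Nat.exists_eq_add_of_le hu
        have : degreeSums D c 1 (i + 1) (c + v) = degreeSums D 0 0 i v := by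
          ext A
          rw [mem_degreeSums, mem_degreeSums]
          omega
        rw [bettiNumber_gluedSeq_succ ha hc0 hac hc, hD, hD, this]
  · have hP : degreeSums (fun t => a * D t) 0 0 i j = ∅ := by
      refine Finset.eq_empty_of_forall_notMem fun A hA => hj ?_
      rw [← (mem_degreeSums.1 hA).2, ← Finset.mul_sum, zero_add]
      exact dvd_mul_right _ _
    have hQ : degreeSums (fun t => a * D t) (a * c) 1 i j = ∅ := by
      refine Finset.eq_empty_of_forall_notMem fun A hA => hj ?_
      rw [← (mem_degreeSums.1 hA).2, ← Finset.mul_sum, ← mul_add]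
      exact dvd_mul_right _ _
    rw [bettiNumber_gluedSeq_of_not_dvd hj, hP, hQ]
    rfl

end DegreeSums

/-! ### Defining ideals of gluings. -/

section Relations

open Polynomial

variable {K : Type*} [Field K] {l q : ℕ}

theorem aeval_X_pow_monomial (n : Fin l → ℕ) (u : Fin l →₀ ℕ) (z : K) :
    MvPolynomial.aeval (fun p => (X : K[X]) ^ n p) (MvPolynomial.monomial u z) =
      Polynomial.monomial (Finsupp.weight n u) z := by
  rw [MvPolynomial.aeval_monomial, ← C_mul_X_pow_eq_monomial, algebraMap_eq, Finsupp.weight_apply,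
    Finsupp.prod, Finsupp.sum, ← Finset.prod_pow_eq_pow_sum]
  congr 1
  refine Finset.prod_congr rfl fun p _ => ?_
  rw [← pow_mul, smul_eq_mul, mul_comm]

/-- An ideal of relations that identifies all monomials of the same degree is the full ideal. -/
theorem eq_definingIdeal {n : Fin l → ℕ} {J : Ideal (MvPolynomial (Fin l) K)}
    (hle : J ≤ definingIdeal K n)
    (h : ∀ u v : Fin l →₀ ℕ, Finsupp.weight n u = Finsupp.weight n v →
      MvPolynomial.monomial u (1 : K) - MvPolynomial.monomial v 1 ∈ J) :
    J = definingIdeal K n := by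
  refine le_antisymm hle fun P hP => ?_
  -- One monomial is chosen in each attained degree. With `L` sending `t ^ w` to it, every `P` is
  -- congruent modulo `J` to `L` of its image in `K[t]`, which is zero for `P` in the defining
  -- ideal.
  have hs : ∀ w : ℕ, ∃ v : Fin l →₀ ℕ, ∀ u : Fin l →₀ ℕ, Finsupp.weight n u = w → Finsupp.weight n v = w := by
    intro w
    by_cases hw : ∃ v : Fin l →₀ ℕ, Finsupp.weight n v = w
    · exact ⟨hw.choose, fun _ _ => hw.choose_spec⟩
    · exact ⟨0, fun u hu => absurd ⟨u, hu⟩ hw⟩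
  choose σ hσ using hs
  let L : K[X] →ₗ[K] MvPolynomial (Fin l) K := Polynomial.lsum fun w =>
    LinearMap.toSpanSingleton K _ (MvPolynomial.monomial (σ w) 1)
  have key : ∀ P : MvPolynomial (Fin l) K,
      P - L (MvPolynomial.aeval (fun p => (X : K[X]) ^ n p) P) ∈ J := by
    intro P
    induction P using MvPolynomial.induction_on' with
    | monomial u z =>
      have hL : L (Polynomial.monomial (Finsupp.weight n u) z) =
          MvPolynomial.C z * MvPolynomial.monomial (σ (Finsupp.weight n u)) 1 := by
        simp [L, Polynomial.sum_monomial_index, MvPolynomial.C_mul_monomial,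
          MvPolynomial.smul_monomial]
      have hu : MvPolynomial.monomial u z = MvPolynomial.C z * MvPolynomial.monomial u 1 := by
        simp [MvPolynomial.C_mul_monomial]
      rw [aeval_X_pow_monomial, hL, hu, ← mul_sub]
      exact J.mul_mem_left _ (h _ _ (hσ _ u rfl).symm)
    | add P Q hP hQ =>
      rw [map_add, map_add, add_sub_add_comm]
      exact J.add_mem hP hQ
  have hP0 : MvPolynomial.aeval (fun p => (X : K[X]) ^ n p) P = 0 := hP
  have := key P
  rwa [hP0, map_zero, sub_zero] at this

/-- Relations of positive degrees `D` that identify all monomials of the same degree; for each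
relation there is a point over the algebraic closure where it is the only one not to vanish. -/
structure IsSeparatedPresentation (n : Fin l → ℕ) (D : Fin q → ℕ)
    (F : Fin q → MvPolynomial (Fin l) K) : Prop where
  homogeneous : ∀ t, MvPolynomial.IsWeightedHomogeneous n (F t) (D t)
  degree_pos : ∀ t, 0 < D t
  mem : ∀ t, F t ∈ definingIdeal K n
  monomial_sub_mem : ∀ u v : Fin l →₀ ℕ, Finsupp.weight n u = Finsupp.weight n v →
    MvPolynomial.monomial u 1 - MvPolynomial.monomial v 1 ∈ Ideal.span (Set.range F)
  exists_point : ∀ t, ∃ x : Fin l → AlgebraicClosure K,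
    (∀ s ≠ t, MvPolynomial.aeval x (F s) = 0) ∧ MvPolynomial.aeval x (F t) ≠ 0

/-- Irredundancy is read off from the points: the ideal of the other relations vanishes at a point
where `F t` does not. -/
theorem IsSeparatedPresentation.isRelationDegrees {n : Fin l → ℕ} {D : Fin q → ℕ}
    {F : Fin q → MvPolynomial (Fin l) K} (h : IsSeparatedPresentation n D F) :
    IsRelationDegrees K n D := by
  refine ⟨F, h.homogeneous, eq_definingIdeal ?_ h.monomial_sub_mem, fun t ht => ?_⟩
  · rw [Ideal.span_le]
    rintro _ ⟨t, rfl⟩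
    exact h.mem t
  · obtain ⟨x, hx, hxt⟩ := h.exists_point t
    have : Ideal.span (F '' {t}ᶜ) ≤ RingHom.ker (MvPolynomial.aeval x : _ →ₐ[K] _) := by
      rw [Ideal.span_le]
      rintro _ ⟨s, hs, rfl⟩
      exact hx s hs
    exact hxt (this ht)

theorem weight_gluedSeq (a c : ℕ) (n : Fin l → ℕ) (u : Fin (l + 1) →₀ ℕ) :
    Finsupp.weight (gluedSeq a n c) u =
      a * Finsupp.weight n (u.comapDomain Fin.castSucc (Fin.castSucc_injective l).injOn) +
        u (Fin.last l) * c := by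
  rw [Finsupp.weight_apply, Finsupp.weight_apply, Finsupp.sum_fintype _ _ (by simp),
    Finsupp.sum_fintype _ _ (by simp), Fin.sum_univ_castSucc, Finset.mul_sum]
  simp only [gluedSeq_castSucc, gluedSeq_last, smul_eq_mul, Finsupp.comapDomain_apply]
  congr 1
  exact Finset.sum_congr rfl fun p _ => by ring

theorem monomial_eq_rename_mul (u : Fin (l + 1) →₀ ℕ) :
    MvPolynomial.monomial u (1 : K) = MvPolynomial.rename Fin.castSucc (MvPolynomial.monomial
      (u.comapDomain Fin.castSucc (Fin.castSucc_injective l).injOn) 1) *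
        MvPolynomial.X (Fin.last l) ^ u (Fin.last l) := by
  rw [MvPolynomial.rename_monomial, MvPolynomial.X_pow_eq_monomial, MvPolynomial.monomial_mul,
    mul_one]
  refine congrArg (fun v => MvPolynomial.monomial v (1 : K)) ?_
  ext p
  induction p using Fin.lastCases with
  | last =>
    rw [Finsupp.add_apply, Finsupp.mapDomain_of_notMem_range, Finsupp.single_eq_same, zero_add]
    rintro ⟨p, hp⟩
    exact (Fin.castSucc_lt_last p).ne hp
  | cast p =>
    rw [Finsupp.add_apply, Finsupp.mapDomain_apply (Fin.castSucc_injective l),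
      Finsupp.comapDomain_apply, Finsupp.single_eq_of_ne (Fin.castSucc_lt_last p).ne, add_zero]

theorem weight_mapDomain_castSucc (a c : ℕ) (n : Fin l → ℕ) (u : Fin l →₀ ℕ) :
    Finsupp.weight (gluedSeq a n c) (u.mapDomain Fin.castSucc) = a * Finsupp.weight n u := by
  rw [weight_gluedSeq, Finsupp.comapDomain_mapDomain _ (Fin.castSucc_injective l),
    Finsupp.mapDomain_of_notMem_range, zero_mul, add_zero]
  rintro ⟨p, hp⟩
  exact (Fin.castSucc_lt_last p).ne hp

/-- The relations of a gluing: those of the original ring and `X_l ^ a - X ^ u`. -/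
noncomputable def gluedRelations (a : ℕ) (u : Fin l →₀ ℕ) (F : Fin q → MvPolynomial (Fin l) K) :
    Fin (q + 1) → MvPolynomial (Fin (l + 1)) K :=
  Fin.snoc (α := fun _ => MvPolynomial (Fin (l + 1)) K)
    (fun t => MvPolynomial.rename Fin.castSucc (F t))
    (MvPolynomial.X (Fin.last l) ^ a -
      MvPolynomial.rename Fin.castSucc (MvPolynomial.monomial u 1))

theorem gluedRelations_castSucc (a : ℕ) (u : Fin l →₀ ℕ) (F : Fin q → MvPolynomial (Fin l) K)
    (t : Fin q) : gluedRelations a u F t.castSucc = MvPolynomial.rename Fin.castSucc (F t) := by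
  simp [gluedRelations]

theorem gluedRelations_last (a : ℕ) (u : Fin l →₀ ℕ) (F : Fin q → MvPolynomial (Fin l) K) :
    gluedRelations a u F (Fin.last q) = MvPolynomial.X (Fin.last l) ^ a -
      MvPolynomial.rename Fin.castSucc (MvPolynomial.monomial u 1) := by
  simp [gluedRelations]

theorem gluedRelations_monomial_sub_mem {n : Fin l → ℕ} {F : Fin q → MvPolynomial (Fin l) K}
    (hF : ∀ u v : Fin l →₀ ℕ, Finsupp.weight n u = Finsupp.weight n v →
      MvPolynomial.monomial u 1 - MvPolynomial.monomial v 1 ∈ Ideal.span (Set.range F))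
    {a : ℕ} {u₀ : Fin l →₀ ℕ} (ha : 0 < a) (hac : a.Coprime (Finsupp.weight n u₀))
    (u v : Fin (l + 1) →₀ ℕ) (huv : Finsupp.weight (gluedSeq a n (Finsupp.weight n u₀)) u =
      Finsupp.weight (gluedSeq a n (Finsupp.weight n u₀)) v) :
    MvPolynomial.monomial u 1 - MvPolynomial.monomial v 1 ∈
      Ideal.span (Set.range (gluedRelations a u₀ F)) := by
  obtain ⟨J, hJ⟩ : ∃ J, J = Ideal.span (Set.range (gluedRelations a u₀ F)) := ⟨_, rfl⟩
  have hmem : ∀ t, gluedRelations a u₀ F t ∈ J := fun t => by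
    rw [hJ]
    exact Ideal.subset_span ⟨t, rfl⟩
  have hren : ∀ P ∈ Ideal.span (Set.range F), MvPolynomial.rename Fin.castSucc P ∈ J := by
    intro P hP
    have : Ideal.span (Set.range F) ≤ J.comap (MvPolynomial.rename Fin.castSucc) := by
      rw [Ideal.span_le]
      rintro _ ⟨t, rfl⟩
      rw [SetLike.mem_coe, Ideal.mem_comap, ← gluedRelations_castSucc a u₀]
      exact hmem _
    exact this hP
  have hpow : Ideal.Quotient.mk J (MvPolynomial.X (Fin.last l) ^ a) =
      Ideal.Quotient.mk J (MvPolynomial.rename Fin.castSucc (MvPolynomial.monomial u₀ 1)) := by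
    rw [Ideal.Quotient.eq, ← gluedRelations_last a u₀ F]
    exact hmem _
  -- Replacing `X_l ^ a` by `X ^ u₀` gives each monomial a normal form with exponent `e < a` in the
  -- last variable.
  have red : ∀ u : Fin (l + 1) →₀ ℕ, ∃ (w : Fin l →₀ ℕ), ∃ e < a,
      Finsupp.weight (gluedSeq a n (Finsupp.weight n u₀)) u =
        a * Finsupp.weight n w + e * Finsupp.weight n u₀ ∧
      Ideal.Quotient.mk J (MvPolynomial.monomial u 1) = Ideal.Quotient.mk J
        (MvPolynomial.rename Fin.castSucc (MvPolynomial.monomial w 1) *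
          MvPolynomial.X (Fin.last l) ^ e) := by
    intro u
    have hdiv := Nat.div_add_mod (u (Fin.last l)) a
    refine ⟨u.comapDomain Fin.castSucc (Fin.castSucc_injective l).injOn +
      (u (Fin.last l) / a) • u₀, u (Fin.last l) % a, Nat.mod_lt _ ha, ?_, ?_⟩
    · rw [weight_gluedSeq, map_add, map_nsmul, smul_eq_mul]
      conv_lhs => rw [← hdiv]
      ring
    · have hw : MvPolynomial.monomial (u.comapDomain Fin.castSucc
          (Fin.castSucc_injective l).injOn + (u (Fin.last l) / a) • u₀) (1 : K) =
          MvPolynomial.monomial (u.comapDomain Fin.castSucc (Fin.castSucc_injective l).injOn) 1 *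
            MvPolynomial.monomial u₀ 1 ^ (u (Fin.last l) / a) := by
        rw [MvPolynomial.monomial_pow, MvPolynomial.monomial_mul, one_pow, mul_one]
      have hX : (MvPolynomial.X (Fin.last l) : MvPolynomial (Fin (l + 1)) K) ^ u (Fin.last l) =
          (MvPolynomial.X (Fin.last l) ^ a) ^ (u (Fin.last l) / a) *
            MvPolynomial.X (Fin.last l) ^ (u (Fin.last l) % a) := by
        rw [← pow_mul, ← pow_add, hdiv]
      rw [monomial_eq_rename_mul u, hw, hX]
      simp only [map_mul, map_pow] at hpow ⊢
      rw [hpow]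
      ring
  obtain ⟨w, e, he, hwt, hmk⟩ := red u
  obtain ⟨w', e', he', hwt', hmk'⟩ := red v
  rw [hwt, hwt'] at huv
  -- The weight determines `e` modulo `a` since `c` is invertible there; equality follows from `e,
  -- e' < a`.
  have hmod : e = e' := by
    have h1 : e * Finsupp.weight n u₀ ≡ e' * Finsupp.weight n u₀ [MOD a] := by
      have := congrArg (· % a) huv
      simpa [Nat.ModEq] using this
    have h2 := Nat.ModEq.cancel_right_of_coprime hac h1
    rwa [Nat.ModEq, Nat.mod_eq_of_lt he, Nat.mod_eq_of_lt he'] at h2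
  subst hmod
  have hww : Finsupp.weight n w = Finsupp.weight n w' :=
    Nat.eq_of_mul_eq_mul_left ha (Nat.add_right_cancel huv)
  rw [← hJ, ← Ideal.Quotient.eq, hmk, hmk', Ideal.Quotient.eq, ← sub_mul, ← map_sub]
  exact J.mul_mem_right _ (hren _ (hF w w' hww))

theorem rename_mem_definingIdeal {n : Fin l → ℕ} {P : MvPolynomial (Fin l) K}
    (hP : P ∈ definingIdeal K n) (a c : ℕ) :
    MvPolynomial.rename Fin.castSucc P ∈ definingIdeal K (gluedSeq a n c) := by
  have h0 : MvPolynomial.aeval (fun p => (X : K[X]) ^ n p) P = 0 := hP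
  have h1 : MvPolynomial.aeval (fun p => (X : K[X]) ^ gluedSeq a n c p)
      (MvPolynomial.rename Fin.castSucc P) =
      Polynomial.aeval (X ^ a : K[X]) (MvPolynomial.aeval (fun p => (X : K[X]) ^ n p) P) := by
    rw [MvPolynomial.aeval_rename, ← AlgHom.comp_apply, MvPolynomial.comp_aeval]
    congr 2
    funext p
    simp [pow_mul]
  rw [h0, map_zero] at h1
  exact h1

theorem IsSeparatedPresentation.gluedRelations {n : Fin l → ℕ} {D : Fin q → ℕ}
    {F : Fin q → MvPolynomial (Fin l) K} (h : IsSeparatedPresentation n D F)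
    {a : ℕ} {u : Fin l →₀ ℕ} (ha : 0 < a) (hc : 0 < Finsupp.weight n u)
    (hac : a.Coprime (Finsupp.weight n u)) :
    IsSeparatedPresentation (gluedSeq a n (Finsupp.weight n u))
      (gluedSeq a D (a * Finsupp.weight n u)) (gluedRelations a u F) := by
  have hu : u ≠ 0 := by
    rintro rfl
    simp at hc
  refine ⟨fun t => ?_, fun t => ?_, fun t => ?_,
    gluedRelations_monomial_sub_mem h.monomial_sub_mem ha hac, fun t => ?_⟩
  · induction t using Fin.lastCases with
    | last =>
      rw [gluedRelations_last, gluedSeq_last]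
      refine MvPolynomial.IsWeightedHomogeneous.sub ?_ ?_
      · rw [MvPolynomial.X_pow_eq_monomial]
        refine MvPolynomial.isWeightedHomogeneous_monomial _ _ _ ?_
        rw [Finsupp.weight_single, gluedSeq_last, smul_eq_mul]
      · rw [MvPolynomial.rename_monomial]
        exact MvPolynomial.isWeightedHomogeneous_monomial _ _ _ (weight_mapDomain_castSucc _ _ _ _)
    | cast t =>
      rw [gluedRelations_castSucc, gluedSeq_castSucc]
      intro d hd
      obtain ⟨v, rfl, hv⟩ := MvPolynomial.coeff_rename_ne_zero _ _ _ hd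
      rw [weight_mapDomain_castSucc, h.homogeneous t hv]
  · induction t using Fin.lastCases with
    | last => simpa using ⟨ha, hc⟩
    | cast t => simpa using ⟨ha, h.degree_pos t⟩
  · induction t using Fin.lastCases with
    | last =>
      rw [gluedRelations_last, definingIdeal, RingHom.mem_ker, map_sub,
        MvPolynomial.X_pow_eq_monomial, MvPolynomial.rename_monomial]
      rw [aeval_X_pow_monomial, aeval_X_pow_monomial]
      rw [weight_mapDomain_castSucc, Finsupp.weight_single, gluedSeq_last, smul_eq_mul, sub_self]
    | cast t =>
      rw [gluedRelations_castSucc]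
      exact rename_mem_definingIdeal (h.mem t) _ _
  · have hren : ∀ (x : Fin l → AlgebraicClosure K) (y : AlgebraicClosure K)
        (P : MvPolynomial (Fin l) K), MvPolynomial.aeval
          (Fin.snoc (α := fun _ => AlgebraicClosure K) x y)
          (MvPolynomial.rename Fin.castSucc P) = MvPolynomial.aeval x P := by
      intro x y P
      rw [MvPolynomial.aeval_rename]
      congr 2
      funext p
      simp
    induction t using Fin.lastCases with
    | last =>
      -- At `(0, …, 0, 1)` the old relations vanish, having positive degree and so no constant term,
      -- while `X_l ^ a - X ^ u` is `1` because `u ≠ 0`.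
      refine ⟨Fin.snoc (α := fun _ => AlgebraicClosure K) 0 1, fun s hs => ?_, ?_⟩
      · induction s using Fin.lastCases with
        | last => exact absurd rfl hs
        | cast s =>
          rw [gluedRelations_castSucc, hren, MvPolynomial.aeval_zero]
          have : MvPolynomial.constantCoeff (F s) = 0 := by
            refine (h.homogeneous s).coeff_eq_zero 0 ?_
            rw [map_zero]
            exact (h.degree_pos s).ne
          rw [this, map_zero]
      · rw [gluedRelations_last, map_sub, hren, MvPolynomial.aeval_zero, map_pow,
          MvPolynomial.aeval_X, Fin.snoc_last, one_pow, MvPolynomial.constantCoeff_monomial,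
          if_neg hu, map_zero, sub_zero]
        exact one_ne_zero
    | cast t =>
      obtain ⟨x, hx, hxt⟩ := h.exists_point t
      -- An `a`-th root as last coordinate makes the new relation vanish; this is why the points are
      -- taken over the algebraic closure.
      obtain ⟨y, hy⟩ := IsAlgClosed.exists_pow_nat_eq
        (MvPolynomial.aeval x (MvPolynomial.monomial u (1 : K))) ha
      refine ⟨Fin.snoc (α := fun _ => AlgebraicClosure K) x y, fun s hs => ?_, ?_⟩
      · induction s using Fin.lastCases with
        | last =>
          rw [gluedRelations_last, map_sub, hren, map_pow, MvPolynomial.aeval_X, Fin.snoc_last,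
            hy, sub_self]
        | cast s =>
          rw [gluedRelations_castSucc, hren]
          exact hx s fun h => hs (by rw [h])
      · rw [gluedRelations_castSucc, hren]
        exact hxt

end Relations

/-! ### Uniqueness of the degrees of minimal generators. -/

section MinimalGenerators

open MvPolynomial

variable {K : Type*} [Field K] {l q : ℕ}

theorem weightedHomogeneousComponent_mul_right {n : Fin l → ℕ} {F : MvPolynomial (Fin l) K}
    {r : ℕ} (hF : IsWeightedHomogeneous n F r) (j : ℕ) (P : MvPolynomial (Fin l) K) :
    weightedHomogeneousComponent n j (P * F) =
      if r ≤ j then weightedHomogeneousComponent n (j - r) P * F else 0 := by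
  induction P using MvPolynomial.induction_on' with
  | monomial u z =>
    have hu : IsWeightedHomogeneous n (monomial u z) (Finsupp.weight n u) :=
      isWeightedHomogeneous_monomial _ _ _ rfl
    rw [weightedHomogeneousComponent_of_mem (hu.mul hF), weightedHomogeneousComponent_of_mem hu]
    split_ifs <;> first | rfl | omega
  | add P Q hP hQ =>
    rw [add_mul, map_add, hP, hQ]
    split_ifs
    · rw [map_add, add_mul]
    · rw [add_zero]

/-- A homogeneous element of the ideal generated by homogeneous elements `F_s` is a combination
with homogeneous coefficients. -/
theorem eq_sum_weightedHomogeneousComponent {n : Fin l → ℕ} {F : Fin q → MvPolynomial (Fin l) K}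
    {r : Fin q → ℕ} (hF : ∀ t, IsWeightedHomogeneous n (F t) (r t)) {j : ℕ}
    {P : MvPolynomial (Fin l) K} (hP : IsWeightedHomogeneous n P j)
    {b : Fin q → MvPolynomial (Fin l) K} (hb : ∑ s, b s * F s = P) :
    P = ∑ s, if r s ≤ j then weightedHomogeneousComponent n (j - r s) (b s) * F s else 0 := by
  conv_lhs => rw [← weightedHomogeneousComponent_eq_self hP, ← hb, map_sum]
  exact Finset.sum_congr rfl fun s _ => weightedHomogeneousComponent_mul_right (hF s) j (b s)

theorem weightedHomogeneousComponent_zero_eq_C {n : Fin l → ℕ} (hn : ∀ p, 0 < n p)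
    (P : MvPolynomial (Fin l) K) :
    weightedHomogeneousComponent n 0 P = C (coeff 0 P) :=
  weightedHomogeneousComponent_zero _ fun p => (hn p).ne'

/-- The elements of degree `j` of an ideal, modulo the products of its elements with polynomials
without constant term. -/
noncomputable def generatorSpace (n : Fin l → ℕ) (I : Ideal (MvPolynomial (Fin l) K)) (j : ℕ) :
    Submodule K (MvPolynomial (Fin l) K ⧸
      (RingHom.ker (constantCoeff : MvPolynomial (Fin l) K →+* K) * I).restrictScalars K) :=
  (weightedHomogeneousSubmodule K n j ⊓ I.restrictScalars K).map (Submodule.mkQ _)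

/-- In a minimal homogeneous system of generators, the number of generators of degree `j` depends
only on the ideal. -/
theorem finrank_generatorSpace {n : Fin l → ℕ} (hn : ∀ p, 0 < n p)
    {I : Ideal (MvPolynomial (Fin l) K)} {r : Fin q → ℕ} {F : Fin q → MvPolynomial (Fin l) K}
    (hF : ∀ t, IsWeightedHomogeneous n (F t) (r t)) (hI : Ideal.span (Set.range F) = I)
    (hmin : ∀ t, F t ∉ Ideal.span (F '' {t}ᶜ)) (j : ℕ) :
    Module.finrank K (generatorSpace n I j) = Fintype.card {t // r t = j} := by
  have hFI : ∀ t, F t ∈ I := fun t => hI ▸ Ideal.subset_span ⟨t, rfl⟩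
  -- Generators of degree below `j` enter with coefficients of positive degree and die modulo `𝔪I`;
  -- those of degree `j` enter with scalars.
  have hspan : generatorSpace n I j = Submodule.span K (Set.range fun t : {t // r t = j} =>
      Submodule.mkQ ((RingHom.ker (constantCoeff : MvPolynomial (Fin l) K →+* K) *
        I).restrictScalars K) (F t)) := by
    refine le_antisymm ?_ ?_
    · rintro _ ⟨P, ⟨hP, hPI⟩, rfl⟩
      have hPI' : P ∈ I := hPI
      rw [← hI] at hPI'
      obtain ⟨b, hb⟩ := Ideal.mem_span_range_iff_exists_fun.1 hPI'
      have hsum := eq_sum_weightedHomogeneousComponent hF hP hb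
      rw [hsum, map_sum]
      refine Submodule.sum_mem _ fun s _ => ?_
      split_ifs with hs
      · rcases hs.eq_or_lt with h | h
        · rw [h, Nat.sub_self, weightedHomogeneousComponent_zero_eq_C hn, ← smul_eq_C_mul, map_smul]
          exact Submodule.smul_mem _ _ (Submodule.subset_span ⟨⟨s, h⟩, rfl⟩)
        · have hz : Submodule.mkQ ((RingHom.ker (constantCoeff : MvPolynomial (Fin l) K →+* K) *
              I).restrictScalars K)
                (weightedHomogeneousComponent n (j - r s) (b s) * F s) = 0 := by
            rw [Submodule.mkQ_apply, Submodule.Quotient.mk_eq_zero]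
            refine Ideal.mul_mem_mul ?_ (hFI s)
            refine (weightedHomogeneousComponent_isWeightedHomogeneous (j - r s)
              (b s)).coeff_eq_zero 0 ?_
            rw [map_zero]
            omega
          rw [hz]
          exact zero_mem _
      · rw [map_zero]
        exact zero_mem _
    · rw [Submodule.span_le]
      rintro _ ⟨⟨t, rfl⟩, rfl⟩
      exact ⟨F t, ⟨hF t, hFI t⟩, rfl⟩
  rw [hspan]
  -- A linear dependence with `z t ≠ 0` would express `F t` through the other generators, against
  -- minimality.
  refine finrank_span_eq_card (Fintype.linearIndependent_iff.2 fun z hz t => ?_)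
  by_contra hzt
  have hQ : ∑ s : {t // r t = j}, z s • F s ∈
      RingHom.ker (constantCoeff : MvPolynomial (Fin l) K →+* K) * I := by
    simp only [← map_smul, ← map_sum] at hz
    rwa [Submodule.mkQ_apply, Submodule.Quotient.mk_eq_zero] at hz
  have hQh : IsWeightedHomogeneous n (∑ s : {t // r t = j}, z s • F s) j := by
    refine IsWeightedHomogeneous.sum _ _ _ fun s _ => ?_
    have := hF s
    rw [s.2] at this
    exact (weightedHomogeneousSubmodule K n j).smul_mem _ this
  rw [← hI, ← smul_eq_mul, Ideal.span, Submodule.mem_ideal_smul_span_iff_exists_sum] at hQ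
  obtain ⟨b, hbm, hb⟩ := hQ
  rw [Finsupp.sum_fintype _ _ (by simp)] at hb
  have hsum := eq_sum_weightedHomogeneousComponent hF hQh hb
  have hF' : ∀ s, s ≠ (t : Fin q) → F s ∈ Ideal.span (F '' {(t : Fin q)}ᶜ) := fun s hs =>
    Ideal.subset_span ⟨s, hs, rfl⟩
  have hmem : ∑ s : {t // r t = j}, z s • F s ∈ Ideal.span (F '' {(t : Fin q)}ᶜ) := by
    rw [hsum]
    refine Ideal.sum_mem _ fun s _ => ?_
    split_ifs with hs
    -- In degree `j` the coefficient of `F t` is the constant term of `b t`, which is zero because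
    -- `b t ∈ 𝔪`.
    · by_cases h : s = t
      · have h0 : coeff 0 (b s) = 0 := hbm s
        rw [h] at h0
        rw [h, t.2, Nat.sub_self, weightedHomogeneousComponent_zero_eq_C hn, h0, C_0, zero_mul]
        exact zero_mem _
      · exact Ideal.mul_mem_left _ _ (hF' s h)
    · exact zero_mem _
  rw [← Finset.add_sum_erase _ _ (Finset.mem_univ t)] at hmem
  have hrest : ∑ s ∈ Finset.univ.erase t, z s • F s ∈ Ideal.span (F '' {(t : Fin q)}ᶜ) := by
    refine Ideal.sum_mem _ fun s hs => ?_
    rw [smul_eq_C_mul]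
    exact Ideal.mul_mem_left _ _ (hF' s fun h => Finset.ne_of_mem_erase hs (Subtype.ext h))
  have hzF := (Ideal.add_mem_iff_left _ hrest).1 hmem
  have := Ideal.mul_mem_left _ (C (z t)⁻¹) hzF
  rw [smul_eq_C_mul, ← mul_assoc, ← C_mul, inv_mul_cancel₀ hzt, C_1, one_mul] at this
  exact hmin t this

/-- The degrees of the relations are unique up to their order. -/
theorem IsRelationDegrees.exists_perm {n : Fin l → ℕ} (hn : ∀ p, 0 < n p) {r s : Fin q → ℕ}
    (hr : IsRelationDegrees K n r) (hs : IsRelationDegrees K n s) :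
    ∃ σ : Equiv.Perm (Fin q), r = s ∘ σ := by
  obtain ⟨F, hF, hFI, hFmin⟩ := hr
  obtain ⟨G, hG, hGI, hGmin⟩ := hs
  have hcard : ∀ j, Fintype.card {t // r t = j} = Fintype.card {t // s t = j} := fun j => by
    rw [← finrank_generatorSpace hn hF hFI hFmin, ← finrank_generatorSpace hn hG hGI hGmin]
  refine ⟨Equiv.ofFiberEquiv fun j => Fintype.equivOfCardEq (hcard j), funext fun t => ?_⟩
  exact (Equiv.ofFiberEquiv_map _ t).symm

end MinimalGenerators

/-! ### Betti numbers of telescopic semigroup rings. -/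

section Telescopic

variable {K : Type*} [Field K]

theorem degreeSums_isEmpty (D : Fin 0 → ℕ) (i j : ℕ) :
    (degreeSums D 0 0 i j).card = if i = 0 ∧ j = 0 then 1 else 0 := by
  split_ifs with h
  · obtain ⟨rfl, rfl⟩ := h
    rw [Finset.card_eq_one]
    refine ⟨∅, ?_⟩
    ext A
    simp [mem_degreeSums, Subsingleton.elim A ∅]
  · rw [Finset.card_eq_zero]
    refine Finset.eq_empty_of_forall_notMem fun A hA => h ?_
    have := mem_degreeSums.1 hA
    simp only [Subsingleton.elim A ∅, Finset.card_empty, Finset.sum_empty] at this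
    omega

/-- The Koszul complex of the element `t` of `K[t]`, the semigroup ring of the semigroup `ℕ`. -/
theorem bettiNumber_one (D : Fin 0 → ℕ) (i j : ℕ) :
    bettiNumber K (fun _ : Fin 1 => 1) i j = (degreeSums D 0 0 i j).card := by
  have hmem : ∀ x, x ∈ semigroupOf fun _ : Fin 1 => 1 := fun x => by
    simpa using nsmul_mem (mem_semigroupOf (fun _ : Fin 1 => 1) 0) x
  have hsum : ∀ J : Finset (Fin 1), ∑ _p ∈ J, 1 = J.card := fun J => by simp
  have hzero : ∀ i, divisorFaces (fun _ : Fin 1 => 1) (i + 1) 0 = ∅ := fun i => by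
    refine Set.eq_empty_of_forall_notMem ?_
    rintro J ⟨hJ, x, -, h⟩
    rw [hsum] at h
    omega
  rw [bettiNumber_eq_homologyDim, degreeSums_isEmpty]
  split_ifs with h
  · obtain ⟨rfl, rfl⟩ := h
    have hadd := homologyDim_add
      (simplicialDiff_mem_supportedOn_divisorFaces (K := K) (fun _ : Fin 1 => 1) 0 0)
    have hB : divisorFaces (fun _ : Fin 1 => 1) 0 0 = {∅} := by
      ext J
      constructor
      · rintro ⟨hJ, -⟩
        exact Finset.card_eq_zero.1 hJ
      · rintro rfl
        exact ⟨rfl, 0, hmem 0, rfl⟩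
    have hcyc : cyclesOn K (∅ : Set (Finset (Fin 1))) = ⊥ := by
      rw [cyclesOn, supportedOn_empty, bot_inf_eq]
    rw [hzero, supportedOn_empty, hcyc, finrank_bot, add_zero, add_zero] at hadd
    rw [hzero, hadd, hB]
    refine finrank_eq_one (⟨Pi.single ∅ 1, fun J hJ => ?_, ?_⟩ : cyclesOn K {∅}) ?_ ?_
    · by_contra h
      exact hJ (Pi.single_eq_of_ne h _)
    · rw [SetLike.mem_coe, LinearMap.mem_ker]
      funext J
      rw [simplicialDiff_apply]
      refine Finset.sum_eq_zero fun p _ => ?_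
      rw [Pi.single_eq_of_ne (Finset.insert_ne_empty p J), mul_zero, ite_self]
    · intro h
      have := congrFun (congrArg Subtype.val h) ∅
      simp at this
    · rintro ⟨z, hz, -⟩
      refine ⟨z ∅, Subtype.ext (funext fun J => ?_)⟩
      by_cases hJ : J = ∅
      · subst hJ
        simp
      · have hzJ : z J = 0 := by
          by_contra h
          exact hJ (hz J h)
        simp [hJ, hzJ]
  · rcases j with - | j
    · obtain ⟨i, rfl⟩ := Nat.exists_eq_succ_of_ne_zero fun hi : i = 0 => h ⟨hi, rfl⟩
      rw [Nat.succ_eq_add_one, hzero i, homologyDim_empty]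
    -- In positive degree the single vertex is itself a face, so the complex is a cone over it.
    · refine homologyDim_eq_zero_of_cone 0 fun J hJ hB => ?_
      obtain ⟨hi, -⟩ := hB
      have hcard := Finset.card_erase_add_one hJ
      have hle : J.card ≤ 1 := card_finset_fin_le J
      refine ⟨by omega, j, hmem j, ?_⟩
      rw [hsum]
      omega

/-- Presentation and Betti numbers are carried through one induction over gluings, so that the same
`D` serves for both; the base case is `n = (1)`, without relations. -/
theorem IsTelescopic.exists_presentation : ∀ {k : ℕ} {n : Fin (k + 1) → ℕ}, IsTelescopic n →
    ∃ (D : Fin k → ℕ) (F : Fin k → MvPolynomial (Fin (k + 1)) K),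
      IsSeparatedPresentation n D F ∧
      ∀ i j, bettiNumber K n i j = (degreeSums D 0 0 i j).card
  | 0, n, hn => by
    obtain rfl : n = fun _ => 1 := by
      funext p
      refine Nat.dvd_one.1 ((Finset.dvd_gcd fun s _ => ?_).trans hn.gcd_eq_one.dvd)
      rw [show s = p from Subsingleton.elim (α := Fin 1) s p]
    refine ⟨Fin.elim0, Fin.elim0, ⟨fun t => t.elim0, fun t => t.elim0, fun t => t.elim0,
      fun u v huv => ?_, fun t => t.elim0⟩, bettiNumber_one _⟩
    have : u = v := by
      ext p
      rw [Finsupp.weight_apply, Finsupp.weight_apply, Finsupp.sum_fintype _ _ (by simp),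
        Finsupp.sum_fintype _ _ (by simp)] at huv
      rw [show p = 0 from Subsingleton.elim (α := Fin 1) p 0]
      simpa using huv
    rw [this, sub_self]
    exact zero_mem _
  | k + 1, n, hn => by
    obtain ⟨a, c, n', hn', ha, hc0, hac, hc, rfl⟩ := hn.exists_eq_gluedSeq
    obtain ⟨D, F, hF, hD⟩ := hn'.exists_presentation
    obtain ⟨u, rfl⟩ := exists_weight_eq hc
    refine ⟨_, _, hF.gluedRelations ha hc0 hac, fun i j => ?_⟩
    rw [bettiNumber_gluedSeq hD ha hc0.ne' hac hc, card_degreeSums_gluedSeq]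

/-- The Betti numbers of `⟨2 n_0, …, 2 n_k, m⟩`. -/
theorem IsTelescopic.bettiNumber_doubledWith {k : ℕ} {n : Fin (k + 1) → ℕ} (hn : IsTelescopic n)
    {m : ℕ} (hm : m ∈ semigroupOf n) (hodd : Odd m) {r : Fin k → ℕ}
    (hr : IsRelationDegrees K n r) (i j : ℕ) :
    bettiNumber K (doubledWith n m) i j = (degreeSums (fun t => 2 * r t) 0 0 i j).card +
      (degreeSums (fun t => 2 * r t) (2 * m) 1 i j).card := by
  obtain ⟨D, F, hF, hD⟩ := hn.exists_presentation (K := K)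
  obtain ⟨σ, rfl⟩ := hr.exists_perm hn.pos hF.isRelationDegrees
  have hσ : (fun t => 2 * (D ∘ σ) t) = (fun t => 2 * D t) ∘ σ := rfl
  rw [hσ, card_degreeSums_comp, card_degreeSums_comp]
  -- `doubledWith n m` is `gluedSeq 2 n m` by definition.
  exact bettiNumber_gluedSeq hD two_pos hodd.pos.ne' (Nat.coprime_two_left.2 hodd) hm i j

end Telescopic

theorem mainTheorem6 (K : Type*) [Field K] (k : ℕ) (n : Fin (k + 1) → ℕ) (hn : IsTelescopic n)
    (f : ℤ) (hf_odd : Odd f) (hf : 3 * frobeniusNumber (semigroupOf n) + 1 ≤ f)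
    (m : ℕ) (hm : (m : ℤ) = f - 2 * frobeniusNumber (semigroupOf n)) :
    -- `K[S]` has exactly one relation less than generators
    (∃ r : Fin k → ℕ, IsRelationDegrees K n r) ∧
    -- `N t = 2 * r t`, where `r` lists the degrees of the relations of `K[S]`
    ∀ r N : Fin k → ℕ, IsRelationDegrees K n r → (∀ t, N t = 2 * r t) → ∀ i j : ℕ,
      -- sums of `i` relation degrees
      (degreeSums N 0 0 i j ≠ ∅ → degreeSums N (2 * m) 1 i j = ∅ →
        degreeSums N (2 * m + 4) 1 i j = ∅ →
        bettiNumber K (doubledWith n (m + 2)) i j = bettiNumber K (doubledWith n m) i j) ∧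
      -- `2 (f - 2 g)` plus `i - 1` relation degrees
      (degreeSums N (2 * m) 1 i j ≠ ∅ → degreeSums N 0 0 i j = ∅ →
        degreeSums N (2 * m + 4) 1 i j = ∅ →
        bettiNumber K (doubledWith n (m + 2)) i j = 0) ∧
      -- `2 (f - 2 g) + 4` plus `i - 1` relation degrees
      ((degreeSums N (2 * m + 4) 1 i j).card = 1 → degreeSums N (2 * m) 1 i j = ∅ →
        bettiNumber K (doubledWith n (m + 2)) i j = bettiNumber K (doubledWith n m) i j + 1) ∧
      -- all degrees, coincidences included
      bettiNumber K (doubledWith n (m + 2)) i j + (degreeSums N (2 * m) 1 i j).card =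
        bettiNumber K (doubledWith n m) i j + (degreeSums N (2 * m + 4) 1 i j).card := by
  obtain ⟨D, F, hF, -⟩ := hn.exists_presentation (K := K)
  refine ⟨⟨D, hF.isRelationDegrees⟩, fun r N hr hN i j => ?_⟩
  obtain rfl : N = fun t => 2 * r t := funext hN
  -- The bound `3g + 1 ≤ f` says exactly that `m = f - 2g` exceeds `g`.
  have hmem := mem_semigroupOf_of_frobeniusNumber_lt hn.gcd_eq_one (m := m) (by omega)
  have hmem2 := mem_semigroupOf_of_frobeniusNumber_lt hn.gcd_eq_one (m := m + 2)
    (by push_cast; omega)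
  have hodd : Odd m := by
    obtain ⟨x, hx⟩ := hf_odd
    rw [← Nat.not_even_iff_odd]
    rintro ⟨y, rfl⟩
    omega
  have hodd2 : Odd (m + 2) := hodd.add_even even_two
  have h1 := hn.bettiNumber_doubledWith hmem hodd hr i j
  have h2 := hn.bettiNumber_doubledWith hmem2 hodd2 hr i j
  rw [show 2 * (m + 2) = 2 * m + 4 by ring] at h2
  rw [h1, h2]
  -- After the rewriting, the two Betti numbers read `|P| + |Q|` and `|P| + |R|`.
  refine ⟨fun _ hQ hR => ?_, fun _ hP hR => ?_, fun hR hQ => ?_, by omega⟩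
  · rw [hQ, hR]
  · rw [hP, hR]
    rfl
  · rw [hR, hQ]
    rfl
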